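/- **Setting.** There are $k\ge 1$ players and a class $\mathcal H$ of measurable functions $X\to\{0,1\}$ of VC dimension $d<\infty$ (with the usual measurability assumption of VC theory: for every finite label pattern, the set of tuples of points on which some $h\in\mathcal H$ realizes it is universally measurable). Player $i$ draws independent labelled examples from an unknown distribution $Q_i$ on $X\times\{0,1\}$. The error of $h$ is $\mathrm{err}(h)=\Pr_{(x,y)\sim Q}[h(x)\ne y]$, where $Q=\frac1k\sum_{i=1}^k Q_i$ is the joint mixture. In the *realizable case*, $Q_i$ is the law of $(x,f(x))$ with $x\sim D_i$, for an arbitrary distribution $D_i$ on $X$ and a target $f\in\mathcal H$ common to all players; in the *agnostic case* the $Q_i$ are arbitrary, and $\mathrm{opt}(\mathcal H)=\inf_{h\in\mathcal H}\mathrm{err}(h)$. The players communicate in rounds by sending some of their own labelled examples, and a hypothesis is computed from what has been transmitted. A protocol may depend on $\mathcal H,k,\epsilon$ and the confidence parameter $\delta$, but not on the distributions or the target; "with probability at least $1-\delta$" holds for all distributions (and targets) as above. **Theorem.** 1. (Realizable, one round.) For every $\delta\in(0,1)$ there is a constant $C$ depending only on $\delta$ such that for all $X,\mathcal H,d,k$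 and $0<\epsilon\le\frac12$ there is a one-round protocol that always communicates at most $C\,\frac d\epsilon\log\frac1\epsilon$ examples in total and, in the realizable case, produces with probability at least $1-\delta$ a hypothesis of error at most $\epsilon$. If $k\le\frac d\epsilon\log\frac1\epsilon$ the protocol is deterministic (apart from the random samples); for larger $k$ the players may use a shared uniform random string. 2. (Realizable, mistake bound.) Let $\mathcal H$ be any class of measurable functions (of finite VC dimension or not) whose optimal mistake bound $M$ is finite; that is, $M$ is the minimum, over deterministic online algorithms with measurable predictions, of the largest number of mistakes on any sequence of points labelled by any $f\in\mathcal H$. For all $k\geq 1$ and $\epsilon,\delta>0$ there is a deterministic protocol in the lock-synchronous model (when several players try to transmit in the same round, exactly one of them, no matter which, succeeds) that always uses at most $M$ rounds and at most $M$ communicated examples and, in the realizable case, produces with probability at least $1-\delta$ a hypothesis of error at most $\epsilon$. 3. (Agnostic, one round.) For every $\delta\in(0,1)$ there is a constant $C$ depending only on $\delta$ such that for all $X,\mathcal H,d,k$ and $0<\epsilon\le\frac12$ there is a one-round protocol that always communicates at most $C\,\frac d{\epsilon^2}\log\frac1\epsilon$ examples in total and, in the agnostic case, produces with probability at least $1-\delta$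 a hypothesis of error at most $\mathrm{opt}(\mathcal H)+\epsilon$. If $k\le\frac d{\epsilon^2}\log\frac1\epsilon$ the protocol is deterministic (apart from the random samples); for larger $k$ the players may use a shared uniform random string. -/

import Mathlib

open MeasureTheory
open scoped ENNReal

noncomputable section

namespace DistLearn

/-! ### Concept classes -/

/-- A class `H` of binary concepts shatters the finite set `S` if every labelling of `S` is
realized by a member of `H`. -/
def Shatters {X : Type*} (H : Set (X → Bool)) (S : Finset X) : Prop :=
  ∀ g : X → Bool, ∃ h ∈ H, ∀ x ∈ S, h x = g x

/-- The VC dimension: the supremum of the sizes of the finite shattered sets. -/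
def vcDim {X : Type*} (H : Set (X → Bool)) : ℕ∞ :=
  ⨆ (S : Finset X) (_ : Shatters H S), (S.card : ℕ∞)

/-- The measurability tacitly assumed in VC theory: every concept is measurable, and for every
finite pattern of labels the set of tuples of points on which some concept of `H` realizes the
pattern is universally measurable. Countable classes of measurable concepts, classes with a
countable subclass that is dense for pointwise convergence, and classes indexed in a jointly
measurable way by a Polish space over a standard Borel domain all have this property. -/
structure WellBehaved {X : Type*} [MeasurableSpace X] (H : Set (X → Bool)) : Prop where
  measurable : ∀ h ∈ H, Measurable h
  pattern : ∀ (n : ℕ) (y : Fin n → Bool) (μ : Measure (Fin n → X)), IsProbabilityMeasure μ →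
    NullMeasurableSet {x : Fin n → X | ∃ h ∈ H, ∀ i, h (x i) = y i} μ

/-! ### Distributions of labelled examples -/

/-- The uniform mixture of the distributions of the `k` players. -/
def mixture {Z : Type*} [MeasurableSpace Z] {k : ℕ} (Q : Fin k → Measure Z) : Measure Z :=
  (k : ℝ≥0∞)⁻¹ • ∑ i, Q i

/-- The law of `(x, f x)` where `x` has law `D`. -/
def labelledBy {X : Type*} [MeasurableSpace X] (f : X → Bool) (D : Measure X) :
    Measure (X × Bool) :=
  D.map fun x => (x, f x)

/-- The error of `h`: the probability that it mispredicts the label. -/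
def err {X : Type*} [MeasurableSpace X] (Q : Measure (X × Bool)) (h : X → Bool) : ℝ≥0∞ :=
  Q {z | h z.1 ≠ z.2}

/-- The infimum of the errors of the members of `H`. -/
def opt {X : Type*} [MeasurableSpace X] (H : Set (X → Bool)) (Q : Measure (X × Bool)) : ℝ≥0∞ :=
  ⨅ h ∈ H, err Q h

/-! ### Online learning -/

/-- A deterministic online learner: after seeing the labelled examples `z 0, …, z (n - 1)` it
predicts the label of `x` to be `predict n z x`. Predictions are measurable. -/
structure OnlineAlgorithm (X : Type*) [MeasurableSpace X] where
  predict : (n : ℕ) → (Fin n → X × Bool) → X → Bool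
  measurable_predict : ∀ n,
    Measurable fun p : (Fin n → X × Bool) × X => predict n p.1 p.2

/-- The number of mistakes made by `A` when the points `x 0, …, x (T - 1)` are presented one after
the other, the label `f (x t)` of each being revealed after the prediction. -/
def OnlineAlgorithm.mistakes {X : Type*} [MeasurableSpace X] (A : OnlineAlgorithm X)
    (f : X → Bool) (T : ℕ) (x : ℕ → X) : ℕ :=
  ((Finset.range T).filter fun t =>
    A.predict t (fun s : Fin t => (x s, f (x s))) (x t) ≠ f (x t)).card

/-- The mistake bound of `A` for the class `H`: the worst case number of mistakes. -/
def OnlineAlgorithm.mistakeBound {X : Type*} [MeasurableSpace X] (A : OnlineAlgorithm X)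
    (H : Set (X → Bool)) : ℕ∞ :=
  ⨆ (f : X → Bool) (_ : f ∈ H) (T : ℕ) (x : ℕ → X), (A.mistakes f T x : ℕ∞)

/-- The optimal mistake bound of the class `H`. -/
def optimalMistakeBound {X : Type*} [MeasurableSpace X] (H : Set (X → Bool)) : ℕ∞ :=
  ⨅ A : OnlineAlgorithm X, A.mistakeBound H

/-! ### Communication protocols -/

/-- What has been transmitted: for each past round (the oldest first) and each player, the list
of labelled examples of that player that got through. -/
abbrev Transcript (X : Type*) (k : ℕ) : Type _ := List (Fin k → List (X × Bool))

/-- The communication channel: in round `t`, if the players in `S` try to transmit, then the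
players in `c t S` get through. -/
abbrev Channel (k : ℕ) : Type := ℕ → Finset (Fin k) → Finset (Fin k)

/-- The channel on which all transmissions succeed. -/
def Channel.simultaneous (k : ℕ) : Channel k := fun _ S => S

/-- The lock-synchronous channel: of the players that try to transmit in the same time slot,
exactly one succeeds, and nothing is assumed about which one. -/
def Channel.IsLockSynchronous {k : ℕ} (c : Channel k) : Prop :=
  ∀ (t : ℕ) (S : Finset (Fin k)), S.Nonempty → ∃ i ∈ S, c t S = {i}

/-- A deterministic protocol for `k` players that communicate by sending some of their own
labelled examples. Each player first draws `sampleSize` labelled examples. In each of the `rounds`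
rounds, each player chooses which of its own examples to send (none at all: it does not transmit)
from the transcript so far and its own sample. The final hypothesis depends on the
transcript only, so that a center, or any player that hears the transcript, can compute it. -/
structure Protocol (X : Type*) [MeasurableSpace X] (k : ℕ) where
  rounds : ℕ
  sampleSize : ℕ
  send : Transcript X k → Fin k → (Fin sampleSize → X × Bool) → List (Fin sampleSize)
  output : Transcript X k → X → Bool
  measurable_output : ∀ τ, Measurable (output τ)

namespace Protocol

variable {X : Type*} [MeasurableSpace X] {k : ℕ}

/-- The labelled examples that player `i`, whose sample is `z i`, tries to send after the
transcript `τ`. -/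
def message (P : Protocol X k) (z : Fin k → Fin P.sampleSize → X × Bool) (τ : Transcript X k)
    (i : Fin k) : List (X × Bool) :=
  (P.send τ i (z i)).map (z i)

/-- The transcript of the first `t` rounds of the protocol over the channel `c`, where
`z i` is the labelled sample of player `i`. -/
def transcript (P : Protocol X k) (c : Channel k) (z : Fin k → Fin P.sampleSize → X × Bool) :
    ℕ → Transcript X k
  | 0 => []
  | t + 1 =>
    let τ := P.transcript c z t
    τ ++ [fun i =>
      if i ∈ c t (Finset.univ.filter fun j => 0 < (P.message z τ j).length) then
        P.message z τ i
      else []]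

/-- The total number of examples communicated. -/
def examplesSent (P : Protocol X k) (c : Channel k)
    (z : Fin k → Fin P.sampleSize → X × Bool) : ℕ :=
  ((P.transcript c z P.rounds).map fun m => ∑ i, (m i).length).sum

/-- The hypothesis produced at the end. -/
def hypothesis (P : Protocol X k) (c : Channel k)
    (z : Fin k → Fin P.sampleSize → X × Bool) : X → Bool :=
  P.output (P.transcript c z P.rounds)

/-- The (outer) probability that the error of the final hypothesis on the mixture of the `Q i`
exceeds `b`, when all the labelled examples of player `i` are drawn from `Q i`, independently. -/
def failureProb (P : Protocol X k) (c : Channel k) (Q : Fin k → Measure (X × Bool))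
    (b : ℝ≥0∞) : ℝ≥0∞ :=
  Measure.pi (fun p : Fin k × Fin P.sampleSize => Q p.1)
    {z | b < err (mixture Q) (P.hypothesis c fun i j => z (i, j))}

end Protocol

/-- `B` is the allowed order of the number of examples. For `s` equally likely values of a random
string shared by the players, `P r` is the protocol followed when its value is `r`. All
these protocols take one round and send at most `m` examples, whatever the data are. No random
string is used (`s = 1`) when there are at most `B` players. -/
structure IsOneRound {X : Type*} [MeasurableSpace X] {k s : ℕ} (P : Fin s → Protocol X k)
    (B m : ℝ) : Prop where
  pos : 0 < s
  deterministic : (k : ℝ) ≤ B → s = 1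
  rounds_eq : ∀ r, (P r).rounds = 1
  examples_le : ∀ r z, ((P r).examplesSent (Channel.simultaneous k) z : ℝ) ≤ m

/-- The failure probability of a one-round protocol with shared random string, uniformly
distributed over `Fin s` and independent of the data. -/
def sharedFailureProb {X : Type*} [MeasurableSpace X] {k s : ℕ} (P : Fin s → Protocol X k)
    (Q : Fin k → Measure (X × Bool)) (b : ℝ≥0∞) : ℝ≥0∞ :=
  (s : ℝ≥0∞)⁻¹ * ∑ r, (P r).failureProb (Channel.simultaneous k) Q b

end DistLearn

end

open MeasureTheory
open scoped ENNReal

noncomputable section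

namespace DistLearn

/-! ### Growth function -/

section Growth

variable {X J : Type*} [Fintype J] [DecidableEq J]

/-! One round. The players pool m examples and output an empirical risk minimizer in H. These
examples are independent but need not be identically distributed; the learning bounds ask only that
their laws average to the mixture. Symmetrization survives this: swapping an example with the ghost
example of the same index preserves the product measure, whatever the individual laws are. A concept
that is bad on the sample is confirmed by at least half of the ghost samples (Chebyshev,
`pi_abs_weight_sub_ge_le`). For a fixed double sample, Sauer–Shelah leaves few traces, and each
trace is bad for few swaps. This gives `pi_ermFailure_realizable_le` and
`pi_ermFailure_agnostic_le`. With at most B players, equal shares make the average of the laws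
exactly the mixture, and rounding up costs at most one example per player. With more players, the
shared string draws a player for each example, so that averaging over the string yields independent
draws from the mixture. Both cases are in `exists_isOneRound`. Mistake bound. Run an optimal online
learner on the transmitted examples, where players transmit only examples that the current
hypothesis mispredicts. Every example that gets through is a mistake, so there are at most M. If
there are M, any disagreement with the target would be one mistake too many, so the hypothesis is
the target. Otherwise some round was silent and the hypothesis is consistent with all samples, while
it is computed from fewer than M of them. A union bound over the index tuples that could have
produced it, each hypothesis being tested on the untouched examples, bounds the failure probability
(`onlineProtocol_failureProb_le`). It covers every behaviour of the channel at once. -/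

open Classical in
/-- The subsets of the index set `J` cut out by the members of `H` along `x`. -/
def traces (H : Set (X → Bool)) (x : J → X) : Finset (Finset J) :=
  Finset.univ.filter fun S => ∃ h ∈ H, ∀ j, j ∈ S ↔ h (x j) = true

/-- A trace contains both or neither of two indices with the same point, so x is injective on a
shattered index set, and its image is shattered by H. Repeated points therefore do no harm. -/
theorem vcDim_traces_le {H : Set (X → Bool)} {d : ℕ} (hH : vcDim H ≤ d) (x : J → X) :
    (traces H x).vcDim ≤ d := by
  classical
  refine Finset.sup_le fun S hS => ?_
  rw [Finset.mem_shatterer] at hS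
  have hinj : Set.InjOn x S := by
    intro a ha b hb hab
    by_contra hne
    obtain ⟨T, hT, hST⟩ := hS.exists_inter_eq_singleton ha
    simp only [traces, Finset.mem_filter] at hT
    obtain ⟨-, h, -, hh⟩ := hT
    have haT : a ∈ T := by
      have : a ∈ S ∩ T := by rw [hST]; simp
      exact (Finset.mem_inter.1 this).2
    have hbT : b ∈ T := by rw [hh, ← hab, ← hh]; exact haT
    have : b ∈ S ∩ T := Finset.mem_inter.2 ⟨hb, hbT⟩
    rw [hST, Finset.mem_singleton] at this
    exact hne this.symm
  have hsh : Shatters H (S.image x) := by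
    intro g
    obtain ⟨T, hT, hST⟩ := hS (t := S.filter fun j => g (x j) = true) (Finset.filter_subset _ _)
    simp only [traces, Finset.mem_filter] at hT
    obtain ⟨-, h, hhH, hh⟩ := hT
    refine ⟨h, hhH, fun y hy => ?_⟩
    obtain ⟨j, hj, rfl⟩ := Finset.mem_image.1 hy
    rw [Bool.eq_iff_iff, ← hh]
    have := congrArg (j ∈ ·) hST
    simpa [hj] using this
  have h1 : ((S.image x).card : ℕ∞) ≤ vcDim H :=
    le_iSup₂ (f := fun (S : Finset X) (_ : Shatters H S) => (S.card : ℕ∞)) _ hsh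
  rw [Finset.card_image_of_injOn hinj] at h1
  exact_mod_cast h1.trans hH

/-- Sauer–Shelah, with the binomial sum weighted by powers of a and compared with (1 + a)^|J|. The
free parameter a is later chosen so that the exponential costs only a fraction of the tail exponent.
-/
theorem card_traces_le {H : Set (X → Bool)} {d : ℕ} (hH : vcDim H ≤ d) (x : J → X) {a : ℝ}
    (ha : 0 < a) (ha1 : a ≤ 1) :
    ((traces H x).card : ℝ) ≤ (1 / a) ^ d * Real.exp (a * Fintype.card J) := by
  have h0 : (traces H x).card ≤ ∑ k ∈ Finset.Iic d, (Fintype.card J).choose k :=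
    ((Finset.card_le_card_shatterer _).trans Finset.card_shatterer_le_sum_vcDim).trans
      (Finset.sum_le_sum_of_subset (Finset.Iic_subset_Iic.2 (vcDim_traces_le hH x)))
  have h1 : a ^ d * ∑ k ∈ Finset.Iic d, ((Fintype.card J).choose k : ℝ)
      ≤ (a + 1) ^ Fintype.card J := by
    rw [add_pow, Finset.mul_sum]
    calc ∑ k ∈ Finset.Iic d, a ^ d * ((Fintype.card J).choose k : ℝ)
        ≤ ∑ k ∈ Finset.Iic d, a ^ k * ((Fintype.card J).choose k : ℝ) := by
          refine Finset.sum_le_sum fun k hk => ?_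
          gcongr 1
          exact pow_le_pow_of_le_one ha.le ha1 (Finset.mem_Iic.1 hk)
      _ = ∑ k ∈ (Finset.Iic d).filter (· ≤ Fintype.card J),
            a ^ k * ((Fintype.card J).choose k : ℝ) := by
          rw [Finset.sum_filter]
          refine Finset.sum_congr rfl fun k _ => ?_
          split_ifs with hk
          · rfl
          · rw [Nat.choose_eq_zero_of_lt (not_le.1 hk)]; simp
      _ ≤ ∑ k ∈ Finset.range (Fintype.card J + 1),
            a ^ k * ((Fintype.card J).choose k : ℝ) := by
          refine Finset.sum_le_sum_of_subset_of_nonneg (fun k hk => ?_) fun k _ _ => by positivity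
          simp only [Finset.mem_filter] at hk
          exact Finset.mem_range.2 (Nat.lt_succ_of_le hk.2)
      _ = _ := by simp
  have h2 : (a + 1) ^ Fintype.card J ≤ Real.exp (a * Fintype.card J) := by
    rw [mul_comm, Real.exp_nat_mul]
    exact pow_le_pow_left₀ (by positivity) (Real.add_one_le_exp a) _
  have h3 : ((traces H x).card : ℝ) ≤ ∑ k ∈ Finset.Iic d, ((Fintype.card J).choose k : ℝ) := by
    exact_mod_cast h0
  have h4 : a ^ d * ((traces H x).card : ℝ) ≤ Real.exp (a * Fintype.card J) :=
    (mul_le_mul_of_nonneg_left h3 (by positivity)).trans (h1.trans h2)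
  have h5 : (0 : ℝ) < a ^ d := by positivity
  rw [one_div, inv_pow, ← div_eq_inv_mul, le_div_iff₀ h5, mul_comm]
  exact h4

end Growth

/-! ### Symmetrization -/

section Symmetrization

variable {X ι : Type*}

/-- Which of the labelled examples are mispredicted by `h`. -/
def errPattern (h : X → Bool) (z : ι → X × Bool) (i : ι) : Bool := xor (h (z i).1) (z i).2

/-- The number of marked indices. -/
def weight [Fintype ι] (a : ι → Bool) : ℕ := (Finset.univ.filter fun i => a i = true).card

/-- Take `v i` where `σ i` holds, `u i` elsewhere. -/
def select {Z : Type*} (σ : ι → Bool) (u v : ι → Z) (i : ι) : Z := if σ i then v i else u i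

theorem errPattern_select (h : X → Bool) (σ : ι → Bool) (z z' : ι → X × Bool) :
    errPattern h (select σ z z') = select σ (errPattern h z) (errPattern h z') := by
  funext i
  simp only [errPattern, select]
  split_ifs <;> rfl

variable [MeasurableSpace X] [Fintype ι]

/-- The swaps `σ` of a sample with a ghost sample preserve the product measure. -/
theorem measurePreserving_swap {Z : Type*} [MeasurableSpace Z] (Q : ι → Measure Z)
    [∀ i, IsProbabilityMeasure (Q i)] (σ : ι → Bool) :
    MeasurePreserving (fun w : (ι → Z) × (ι → Z) => (select σ w.1 w.2, select σ w.2 w.1))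
      ((Measure.pi Q).prod (Measure.pi Q)) ((Measure.pi Q).prod (Measure.pi Q)) := by
  have he := measurePreserving_arrowProdEquivProdArrow Z Z ι Q Q
  have hs : ∀ i, MeasurePreserving (if σ i then Prod.swap else id : Z × Z → Z × Z)
      ((Q i).prod (Q i)) ((Q i).prod (Q i)) := by
    intro i
    split_ifs
    · exact Measure.measurePreserving_swap
    · exact MeasurePreserving.id _
  have hp := measurePreserving_pi (fun i => (Q i).prod (Q i)) (fun i => (Q i).prod (Q i)) hs
  have := (he.comp hp).comp he.symm
  convert this using 1
  funext w
  ext i <;>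
  · simp only [select, Function.comp, MeasurableEquiv.arrowProdEquivProdArrow,
      Equiv.arrowProdEquivProdArrow]
    by_cases h : σ i <;> simp [h]

/-- The event that some concept has error patterns on the two samples related by `R`. -/
def doubleEvent (H : Set (X → Bool)) (R : (ι → Bool) → (ι → Bool) → Prop) :
    Set ((ι → X × Bool) × (ι → X × Bool)) :=
  {w | ∃ h ∈ H, R (errPattern h w.1) (errPattern h w.2)}

theorem WellBehaved.nullMeasurableSet_pattern {H : Set (X → Bool)} (hH : WellBehaved H)
    {J Ω : Type*} [Fintype J] [MeasurableSpace Ω] (μ : Measure Ω) [IsProbabilityMeasure μ]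
    {x : Ω → J → X} (hx : Measurable x) (v : J → Bool) :
    NullMeasurableSet {w | ∃ h ∈ H, ∀ j, h (x w j) = v j} μ := by
  let e := Fintype.equivFin J
  have hm : Measurable fun w (i : Fin (Fintype.card J)) => x w (e.symm i) :=
    measurable_pi_lambda _ fun i => (measurable_pi_apply _).comp hx
  have := (hH.pattern _ (fun i => v (e.symm i)) (μ.map _)
    (Measure.isProbabilityMeasure_map hm.aemeasurable)).preimage (hm.quasiMeasurePreserving μ)
  convert this using 1
  ext w
  simp only [Set.mem_ofPred_eq, Set.mem_preimage]
  refine exists_congr fun h => and_congr_right fun _ => ?_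
  exact e.symm.forall_congr_left.trans (by simp) |>.symm

/-- A concept matters only through its values on the finitely many points of the double sample, so
the event is a finite union of pattern events, each cut by a condition on the labels. -/
theorem WellBehaved.nullMeasurableSet_doubleEvent {H : Set (X → Bool)} (hH : WellBehaved H)
    (R : (ι → Bool) → (ι → Bool) → Prop) (μ : Measure ((ι → X × Bool) × (ι → X × Bool)))
    [IsProbabilityMeasure μ] : NullMeasurableSet (doubleEvent H R) μ := by
  classical
  let x : (ι → X × Bool) × (ι → X × Bool) → ι ⊕ ι → X := fun w =>
    Sum.elim (fun i => (w.1 i).1) (fun i => (w.2 i).1)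
  have hx : Measurable x := by
    refine measurable_pi_lambda _ fun j => ?_
    rcases j with i | i <;> simp only [x, Sum.elim_inl, Sum.elim_inr] <;> fun_prop
  let y : (ι → X × Bool) × (ι → X × Bool) → (ι → Bool) × (ι → Bool) := fun w =>
    (fun i => (w.1 i).2, fun i => (w.2 i).2)
  have hy : Measurable y := by fun_prop
  have : doubleEvent H R = ⋃ v : ι ⊕ ι → Bool, {w | ∃ h ∈ H, ∀ j, h (x w j) = v j} ∩
      y ⁻¹' {b | R (fun i => xor (v (.inl i)) (b.1 i)) (fun i => xor (v (.inr i)) (b.2 i))} := by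
    ext w
    simp only [doubleEvent, Set.mem_ofPred_eq, Set.mem_iUnion, Set.mem_inter_iff, Set.mem_preimage]
    constructor
    · rintro ⟨h, hh, hR⟩
      exact ⟨fun j => h (x w j), ⟨h, hh, fun _ => rfl⟩, hR⟩
    · rintro ⟨v, ⟨h, hh, hv⟩, hR⟩
      obtain rfl : (fun j => h (x w j)) = v := funext hv
      exact ⟨h, hh, hR⟩
  rw [this]
  refine NullMeasurableSet.iUnion fun v => (hH.nullMeasurableSet_pattern μ hx v).inter ?_
  exact (hy (Set.toFinite _).measurableSet).nullMeasurableSet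

-- Swapping permutes the examples of w without changing the set of points. A union bound over the
-- traces of H on the unswapped points thus serves all swaps simultaneously.
open Classical in
theorem card_swaps_le {X : Type*} {H : Set (X → Bool)}
    {R : (ι → Bool) → (ι → Bool) → Prop} {c G : ℝ}
    (hG : ∀ x : ι ⊕ ι → X, ((traces H x).card : ℝ) ≤ G) (hc0 : 0 ≤ c)
    (hc : ∀ a b : ι → Bool,
      ((Finset.univ.filter fun σ : ι → Bool => R (select σ a b) (select σ b a)).card : ℝ) ≤ c)
    (w : (ι → X × Bool) × (ι → X × Bool)) :
    ((Finset.univ.filter fun σ : ι → Bool =>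
      (select σ w.1 w.2, select σ w.2 w.1) ∈ doubleEvent H R).card : ℝ) ≤ G * c := by
  let x : ι ⊕ ι → X := Sum.elim (fun i => (w.1 i).1) (fun i => (w.2 i).1)
  let a : Finset (ι ⊕ ι) → ι → Bool := fun S i => xor (decide (.inl i ∈ S)) (w.1 i).2
  let b : Finset (ι ⊕ ι) → ι → Bool := fun S i => xor (decide (.inr i ∈ S)) (w.2 i).2
  have hsub : (Finset.univ.filter fun σ : ι → Bool =>
      (select σ w.1 w.2, select σ w.2 w.1) ∈ doubleEvent H R) ⊆
      (traces H x).biUnion fun S => Finset.univ.filter fun σ : ι → Bool =>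
        R (select σ (a S) (b S)) (select σ (b S) (a S)) := by
    intro σ hσ
    simp only [doubleEvent, Finset.mem_filter, Set.mem_ofPred_eq, Finset.mem_univ, true_and,
      errPattern_select] at hσ
    obtain ⟨h, hh, hR⟩ := hσ
    refine Finset.mem_biUnion.2 ⟨Finset.univ.filter fun j => h (x j) = true, ?_, ?_⟩
    · simp only [traces, Finset.mem_filter, Finset.mem_univ, true_and]
      exact ⟨h, hh, fun j => Iff.rfl⟩
    · have ha : a (Finset.univ.filter fun j => h (x j) = true) = errPattern h w.1 := by
        funext i; simp [a, x, errPattern]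
      have hb : b (Finset.univ.filter fun j => h (x j) = true) = errPattern h w.2 := by
        funext i; simp [b, x, errPattern]
      simp only [Finset.mem_filter, Finset.mem_univ, true_and, ha, hb]
      exact hR
  calc _ ≤ (((traces H x).biUnion fun S => Finset.univ.filter fun σ : ι → Bool =>
        R (select σ (a S) (b S)) (select σ (b S) (a S))).card : ℝ) := by
          exact_mod_cast Finset.card_le_card hsub
    _ ≤ ∑ S ∈ traces H x, ((Finset.univ.filter fun σ : ι → Bool =>
        R (select σ (a S) (b S)) (select σ (b S) (a S))).card : ℝ) := by
          exact_mod_cast Finset.card_biUnion_le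
    _ ≤ ∑ S ∈ traces H x, c := Finset.sum_le_sum fun S _ => hc _ _
    _ = (traces H x).card * c := by rw [Finset.sum_const, nsmul_eq_mul]
    _ ≤ G * c := mul_le_mul_of_nonneg_right (hG x) hc0

-- Each swap preserves the measure, so the probability is the average over all swaps; by Fubini it
-- suffices to bound the fraction of bad swaps for each fixed double sample.
open Classical in
theorem WellBehaved.prod_doubleEvent_le {H : Set (X → Bool)} (hH : WellBehaved H)
    {R : (ι → Bool) → (ι → Bool) → Prop} {c G : ℝ} (Q : ι → Measure (X × Bool))
    [∀ i, IsProbabilityMeasure (Q i)]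
    (hG : ∀ x : ι ⊕ ι → X, ((traces H x).card : ℝ) ≤ G) (hc0 : 0 ≤ c)
    (hc : ∀ a b : ι → Bool,
      ((Finset.univ.filter fun σ : ι → Bool => R (select σ a b) (select σ b a)).card : ℝ) ≤
        c * 2 ^ Fintype.card ι) :
    ((Measure.pi Q).prod (Measure.pi Q)) (doubleEvent H R) ≤ ENNReal.ofReal (G * c) := by
  set M := (Measure.pi Q).prod (Measure.pi Q) with hM
  -- The event is only null measurable. A measurable subset of full measure can be integrated and
  -- still inherits the pointwise count.
  obtain ⟨T, hTsub, hTm, hTe⟩ :=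
    (hH.nullMeasurableSet_doubleEvent R M).exists_measurable_subset_ae_eq
  rw [← measure_congr hTe]
  have hsw := fun σ : ι → Bool => measurePreserving_swap Q σ
  have h1 : ∀ σ : ι → Bool, M T = ∫⁻ w, T.indicator 1 (select σ w.1 w.2, select σ w.2 w.1) ∂M := by
    intro σ
    rw [← (hsw σ).measure_preimage hTm.nullMeasurableSet, ← lintegral_indicator_one
      ((hsw σ).measurable hTm)]
    rfl
  have h2 : (2 ^ Fintype.card ι : ℝ≥0∞) * M T ≤ ENNReal.ofReal (G * (c * 2 ^ Fintype.card ι)) := by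
    calc (2 ^ Fintype.card ι : ℝ≥0∞) * M T = ∑ σ : ι → Bool, M T := by
          simp [Finset.sum_const, nsmul_eq_mul]
      _ = ∑ σ : ι → Bool, ∫⁻ w, T.indicator 1 (select σ w.1 w.2, select σ w.2 w.1) ∂M :=
          Finset.sum_congr rfl fun σ _ => h1 σ
      _ = ∫⁻ w, ∑ σ : ι → Bool, T.indicator 1 (select σ w.1 w.2, select σ w.2 w.1) ∂M := by
          rw [lintegral_finsetSum]
          exact fun σ _ => (measurable_one.indicator hTm).comp (hsw σ).measurable
      _ ≤ ∫⁻ w, ENNReal.ofReal (G * (c * 2 ^ Fintype.card ι)) ∂M := by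
          refine lintegral_mono fun w => ?_
          refine le_trans ?_ (ENNReal.ofReal_le_ofReal (card_swaps_le (c := c * 2 ^ Fintype.card ι)
            hG (by positivity) hc w))
          rw [ENNReal.ofReal_natCast, Finset.card_filter, Nat.cast_sum]
          refine Finset.sum_le_sum fun σ _ => ?_
          by_cases h : (select σ w.1 w.2, select σ w.2 w.1) ∈ T
          · simp [h, hTsub h]
          · simp [h]
      _ = _ := by simp
  rw [← mul_assoc, mul_comm, ENNReal.ofReal_mul' (by positivity),
    ENNReal.ofReal_pow (by norm_num), ENNReal.ofReal_ofNat] at h2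
  rwa [ENNReal.mul_le_mul_iff_left (by simp) (by simp)] at h2

open Classical in
/-- If every witness of `E` is confirmed by half of all ghost samples, then `E` is at most twice
as likely as the double event. -/
theorem WellBehaved.pi_le_of_ghost {H : Set (X → Bool)} (hH : WellBehaved H)
    {R : (ι → Bool) → (ι → Bool) → Prop} {c G : ℝ} (Q : ι → Measure (X × Bool))
    [∀ i, IsProbabilityMeasure (Q i)]
    (hG : ∀ x : ι ⊕ ι → X, ((traces H x).card : ℝ) ≤ G) (hc0 : 0 ≤ c)
    (hc : ∀ a b : ι → Bool,
      ((Finset.univ.filter fun σ : ι → Bool => R (select σ a b) (select σ b a)).card : ℝ) ≤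
        c * 2 ^ Fintype.card ι)
    {E : Set (ι → X × Bool)}
    (hE : ∀ z ∈ E, ∃ h ∈ H,
      2⁻¹ ≤ Measure.pi Q {z' | R (errPattern h z) (errPattern h z')}) :
    Measure.pi Q E ≤ ENNReal.ofReal (2 * (G * c)) := by
  set M := (Measure.pi Q).prod (Measure.pi Q) with hM
  have hmain : M (doubleEvent H R) ≤ ENNReal.ofReal (G * c) :=
    hH.prod_doubleEvent_le Q hG hc0 fun a b => hc a b
  -- The measurable hull has the same measure, and Markov's inequality applies to the measures of
  -- its sections; E itself need not be measurable.
  set T := toMeasurable M (doubleEvent H R) with hT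
  have hTm : MeasurableSet T := measurableSet_toMeasurable _ _
  have hsub : E ⊆ {z | 2⁻¹ ≤ Measure.pi Q (Prod.mk z ⁻¹' T)} := by
    intro z hz
    obtain ⟨h, hh, hle⟩ := hE z hz
    refine hle.trans (measure_mono fun z' hz' => subset_toMeasurable _ _ ?_)
    exact ⟨h, hh, hz'⟩
  have h1 := mul_meas_ge_le_lintegral (μ := Measure.pi Q)
    (measurable_measure_prodMk_left (ν := Measure.pi Q) hTm) 2⁻¹
  rw [← Measure.prod_apply hTm, ← hM, hT, measure_toMeasurable] at h1
  have h2 : 2⁻¹ * Measure.pi Q E ≤ ENNReal.ofReal (G * c) :=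
    (mul_le_mul_right (measure_mono hsub) _).trans (h1.trans hmain)
  rw [ENNReal.ofReal_mul (by norm_num), ENNReal.ofReal_ofNat]
  calc Measure.pi Q E = 2 * (2⁻¹ * Measure.pi Q E) := by
        rw [← mul_assoc, ENNReal.mul_inv_cancel (by simp) (by simp), one_mul]
    _ ≤ _ := mul_le_mul_right h2 _

end Symmetrization

/-! ### Counting swaps -/

section Swaps

variable {ι : Type*} [Fintype ι]

theorem weight_eq_sum (a : ι → Bool) : (weight a : ℝ) = ∑ i, ((a i).toNat : ℝ) := by
  rw [weight, Finset.card_filter, Nat.cast_sum]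
  refine Finset.sum_congr rfl fun i _ => ?_
  cases a i <;> simp

open Classical in
/-- A count of swaps is controlled by a product of weights of the individual coordinates. -/
theorem card_filter_le_prod (P : (ι → Bool) → Prop) [DecidablePred P]
    (g : ι → Bool → ℝ) (C r : ℝ)
    (hC : 0 ≤ C) (hg : ∀ i s, 0 ≤ g i s) (hr : ∀ i, g i true + g i false ≤ r)
    (h : ∀ σ, P σ → 1 ≤ C * ∏ i, g i (σ i)) :
    ((Finset.univ.filter P).card : ℝ) ≤ C * r ^ Fintype.card ι := by
  calc ((Finset.univ.filter P).card : ℝ) = ∑ σ, if P σ then (1 : ℝ) else 0 := by simp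
    _ ≤ ∑ σ : ι → Bool, C * ∏ i, g i (σ i) := by
        refine Finset.sum_le_sum fun σ _ => ?_
        split_ifs with hσ
        · exact h σ hσ
        · exact mul_nonneg hC (Finset.prod_nonneg fun i _ => hg i _)
    _ = C * ∏ i, ∑ s : Bool, g i s := by
        rw [← Finset.mul_sum, Finset.prod_univ_sum, Fintype.piFinset_univ]
    _ ≤ C * ∏ _i : ι, r := by
        refine mul_le_mul_of_nonneg_left (Finset.prod_le_prod
          (fun i _ => Finset.sum_nonneg fun s _ => hg i s) fun i _ => ?_) hC
        rw [Fintype.sum_bool]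
        exact hr i
    _ = C * r ^ Fintype.card ι := by rw [Finset.prod_const, Finset.card_univ]

open Classical in
theorem card_swaps_consistent_le (a b : ι → Bool) (t : ℝ) :
    ((Finset.univ.filter fun σ : ι → Bool => weight (select σ a b) = 0 ∧
      t ≤ weight (select σ b a)).card : ℝ) ≤ 2 ^ (-t) * 2 ^ Fintype.card ι := by
  -- An error on the sample side kills the product and one on the ghost side doubles it. In all four
  -- cases the two choices at a coordinate sum to at most 2.
  let g : ι → Bool → ℝ := fun i s => if (if s then b i else a i) = true then 0 else
    if (if s then a i else b i) = true then 2 else 1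
  refine card_filter_le_prod _ g (2 ^ (-t)) 2 (by positivity) ?_ ?_ ?_
  · intro i s
    dsimp only [g]
    split_ifs <;> norm_num
  · intro i
    dsimp only [g]
    cases a i <;> cases b i <;> norm_num
  · rintro σ ⟨h0, ht⟩
    have h0' : ∀ i, select σ a b i = false := by
      intro i
      by_contra hi
      rw [weight, Finset.card_eq_zero] at h0
      have : i ∈ (∅ : Finset ι) := by rw [← h0]; simpa using hi
      simp at this
    have hp : ∏ i, g i (σ i) = 2 ^ weight (select σ b a) := by
      rw [weight, ← Finset.prod_const, Finset.prod_filter]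
      refine Finset.prod_congr rfl fun i _ => ?_
      have := h0' i
      simp only [select] at this
      simp only [g, this, select, Bool.false_eq_true, if_false]
      congr
    rw [hp, ← Real.rpow_natCast, ← Real.rpow_add two_pos]
    exact Real.one_le_rpow one_le_two (by linarith)

open Classical in
theorem card_swaps_deviation_le [Nonempty ι] (a b : ι → Bool) {t : ℝ} (ht : 0 ≤ t) :
    ((Finset.univ.filter fun σ : ι → Bool =>
      t ≤ (weight (select σ a b) : ℝ) - weight (select σ b a)).card : ℝ) ≤
      Real.exp (-(t ^ 2 / (2 * Fintype.card ι))) * 2 ^ Fintype.card ι := by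
  set m := Fintype.card ι with hm
  have hm0 : (0 : ℝ) < m := by exact_mod_cast Fintype.card_pos
  -- Chernoff parameter: this l minimizes -l * t + m * l ^ 2 / 2, with value -t ^ 2 / (2 * m).
  set l := t / m with hl
  let v : Bool → ℝ := fun s => (s.toNat : ℝ)
  have := card_filter_le_prod (fun σ : ι → Bool =>
      t ≤ (weight (select σ a b) : ℝ) - weight (select σ b a))
    (fun i s => Real.exp (l * (v (if s then b i else a i) - v (if s then a i else b i))))
    (Real.exp (-(l * t))) (2 * Real.exp (l ^ 2 / 2)) (by positivity) (fun _ _ => by positivity)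
    ?_ ?_
  · refine this.trans (le_of_eq ?_)
    rw [mul_pow, ← Real.exp_nat_mul, mul_left_comm, ← Real.exp_add, mul_comm]
    congr 2
    rw [hl, ← hm]
    field_simp
    ring
  · intro i
    have key : ∀ u : ℝ, u ^ 2 ≤ 1 → Real.exp (l * u) + Real.exp (l * -u) ≤
        2 * Real.exp (l ^ 2 / 2) := by
      intro u hu
      have h1 := Real.cosh_le_exp_half_sq (l * u)
      rw [Real.cosh_eq] at h1
      have h2 : Real.exp ((l * u) ^ 2 / 2) ≤ Real.exp (l ^ 2 / 2) := by
        apply Real.exp_le_exp.2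
        nlinarith [sq_nonneg l]
      rw [mul_neg]
      linarith
    have := key (v (b i) - v (a i)) (by simp only [v]; cases a i <;> cases b i <;> norm_num)
    simpa using this
  · intro σ hσ
    rw [← Real.exp_sum, ← Real.exp_add, ← Finset.mul_sum, Finset.sum_sub_distrib]
    rw [weight_eq_sum, weight_eq_sum] at hσ
    apply Real.one_le_exp
    have hl0 : 0 ≤ l := by rw [hl]; exact div_nonneg ht hm0.le
    simp only [v]
    simp only [select] at hσ
    have := mul_le_mul_of_nonneg_left hσ hl0
    linarith

open Classical in
theorem card_swaps_abs_deviation_le [Nonempty ι] (a b : ι → Bool) {t : ℝ} (ht : 0 ≤ t) :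
    ((Finset.univ.filter fun σ : ι → Bool =>
      t ≤ |(weight (select σ a b) : ℝ) - weight (select σ b a)|).card : ℝ) ≤
      2 * Real.exp (-(t ^ 2 / (2 * Fintype.card ι))) * 2 ^ Fintype.card ι := by
  have hsub : (Finset.univ.filter fun σ : ι → Bool =>
      t ≤ |(weight (select σ a b) : ℝ) - weight (select σ b a)|) ⊆
      (Finset.univ.filter fun σ : ι → Bool =>
        t ≤ (weight (select σ a b) : ℝ) - weight (select σ b a)) ∪
      (Finset.univ.filter fun σ : ι → Bool =>
        t ≤ (weight (select σ b a) : ℝ) - weight (select σ a b)) := by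
    intro σ hσ
    simp only [Finset.mem_filter, Finset.mem_univ, true_and, Finset.mem_union] at hσ ⊢
    rcases le_abs'.1 hσ with h | h
    · right; linarith
    · left; exact h
  have h1 := card_swaps_deviation_le a b ht
  have h2 := card_swaps_deviation_le b a ht
  have h3 : ((Finset.univ.filter fun σ : ι → Bool =>
      t ≤ |(weight (select σ a b) : ℝ) - weight (select σ b a)|).card : ℝ) ≤ _ :=
    Nat.cast_le.2 ((Finset.card_le_card hsub).trans (Finset.card_union_le _ _))
  push_cast at h3
  linarith

end Swaps

/-! ### Ghost samples -/

section Ghost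

variable {X ι : Type*} [MeasurableSpace X] [Fintype ι]

/-- The average of a finite family of measures. -/
def average {Z : Type*} [MeasurableSpace Z] (Q : ι → Measure Z) : Measure Z :=
  (Fintype.card ι : ℝ≥0∞)⁻¹ • ∑ i, Q i

theorem mixture_eq_average {Z : Type*} [MeasurableSpace Z] {k : ℕ} (Q : Fin k → Measure Z) :
    mixture Q = average Q := by
  simp [mixture, average]

theorem measurableSet_errSet {h : X → Bool} (hh : Measurable h) :
    MeasurableSet {z : X × Bool | h z.1 ≠ z.2} :=
  (measurableSet_eq_fun (hh.comp measurable_fst) measurable_snd).compl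

instance isProbabilityMeasure_average {Z : Type*} [MeasurableSpace Z] [Nonempty ι]
    (Q : ι → Measure Z) [∀ i, IsProbabilityMeasure (Q i)] : IsProbabilityMeasure (average Q) := by
  constructor
  simp only [average, Measure.smul_apply, Measure.finsetSum_apply, measure_univ, smul_eq_mul,
    Finset.sum_const, Finset.card_univ, nsmul_eq_mul, mul_one]
  exact ENNReal.inv_mul_cancel (by simp) (by simp)

theorem sum_real_eq [Nonempty ι] (Q : ι → Measure (X × Bool)) [∀ i, IsProbabilityMeasure (Q i)]
    (h : X → Bool) :
    ∑ i, (Q i).real {z | h z.1 ≠ z.2} = Fintype.card ι * (err (average Q) h).toReal := by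
  have : (Fintype.card ι : ℝ) ≠ 0 := by simp
  simp only [err, average, Measure.smul_apply, Measure.finsetSum_apply, smul_eq_mul,
    ENNReal.toReal_mul, ENNReal.toReal_inv, ENNReal.toReal_natCast]
  rw [ENNReal.toReal_sum (fun _ _ => measure_ne_top _ _), mul_inv_cancel_left₀ this]
  rfl

open ProbabilityTheory in
/-- Chebyshev's inequality for the number of errors of `h`. -/
theorem pi_abs_weight_sub_ge_le [Nonempty ι] (Q : ι → Measure (X × Bool))
    [∀ i, IsProbabilityMeasure (Q i)] {h : X → Bool} (hh : Measurable h) {t : ℝ} (ht : 0 < t) :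
    Measure.pi Q {z | t ≤ |(weight (errPattern h z) : ℝ) -
      Fintype.card ι * (err (average Q) h).toReal|} ≤
      ENNReal.ofReal (Fintype.card ι * (err (average Q) h).toReal / t ^ 2) := by
  set A : Set (X × Bool) := {z | h z.1 ≠ z.2} with hA
  have hAm : MeasurableSet A := measurableSet_errSet hh
  let Y : X × Bool → ℝ := A.indicator 1
  have hYm : Measurable Y := measurable_one.indicator hAm
  have hY01 : ∀ z, Y z ∈ Set.Icc (0 : ℝ) 1 := by
    intro z
    by_cases hz : z ∈ A <;> simp [Y, hz]
  have hYL : ∀ i, MemLp Y 2 (Q i) := fun i =>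
    memLp_of_bounded (a := 0) (b := 1) (Filter.Eventually.of_forall hY01)
      hYm.aestronglyMeasurable 2
  have hYint : ∀ i, ∫ z, Y z ∂Q i = (Q i).real A := fun i => integral_indicator_one hAm
  have hW : ∀ z : ι → X × Bool, (weight (errPattern h z) : ℝ) = ∑ i, Y (z i) := by
    intro z
    rw [weight_eq_sum]
    refine Finset.sum_congr rfl fun i _ => ?_
    simp only [Y, Set.indicator_apply, hA, errPattern, Set.mem_ofPred_eq, Pi.one_apply]
    cases h (z i).1 <;> cases (z i).2 <;> simp
  have hS : MemLp (∑ i, fun z : ι → X × Bool => Y (z i)) 2 (Measure.pi Q) :=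
    memLp_finsetSum' _ fun i _ => (hYL i).comp_measurePreserving (measurePreserving_eval Q i)
  have hE : ∫ z, (∑ i, fun z : ι → X × Bool => Y (z i)) z ∂Measure.pi Q =
      Fintype.card ι * (err (average Q) h).toReal := by
    rw [← sum_real_eq]
    simp only [Finset.sum_apply]
    rw [integral_finsetSum]
    · refine Finset.sum_congr rfl fun i _ => ?_
      rw [integral_comp_eval (μ := Q) hYm.aestronglyMeasurable, hYint]
    · exact fun i _ => ((hYL i).comp_measurePreserving
        (measurePreserving_eval Q i)).integrable (by norm_num)
  -- The variance of an indicator is at most its mean. Bounding by the mean rather than by a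
  -- constant is what permits the rate 1/ε in the realizable case.
  have hV : Var[∑ i, fun z : ι → X × Bool => Y (z i); Measure.pi Q] ≤
      Fintype.card ι * (err (average Q) h).toReal := by
    rw [variance_sum_pi (X := fun _ => Y) hYL, ← sum_real_eq]
    refine Finset.sum_le_sum fun i _ => ?_
    refine (variance_le_expectation_sq hYm.aestronglyMeasurable).trans (le_of_eq ?_)
    rw [← hYint]
    refine integral_congr_ae (Filter.Eventually.of_forall fun z => ?_)
    by_cases hz : z ∈ A <;> simp [Y, hz]
  have := meas_ge_le_variance_div_sq hS ht
  rw [hE] at this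
  simp only [hW]
  simp only [Finset.sum_apply] at this
  refine this.trans (ENNReal.ofReal_le_ofReal ?_)
  gcongr

theorem half_le_pi_of_compl {Z : Type*} [MeasurableSpace Z] {μ : Measure Z}
    [IsProbabilityMeasure μ] {A B : Set Z} {p : ℝ} (hp : p ≤ 1 / 2)
    (hA : μ A ≤ ENNReal.ofReal p) (hAB : Aᶜ ⊆ B) : 2⁻¹ ≤ μ B := by
  have h1 : (1 : ℝ≥0∞) ≤ μ A + μ B := by
    rw [← measure_univ (μ := μ)]
    refine (measure_mono ?_).trans (measure_union_le A B)
    intro z _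
    by_cases hz : z ∈ A
    · exact .inl hz
    · exact .inr (hAB hz)
  have h2 : μ A ≤ 2⁻¹ := hA.trans <| by
    rw [show (2⁻¹ : ℝ≥0∞) = ENNReal.ofReal (1 / 2) by
      rw [one_div, ENNReal.ofReal_inv_of_pos two_pos, ENNReal.ofReal_ofNat]]
    exact ENNReal.ofReal_le_ofReal hp
  have h3 : (2⁻¹ : ℝ≥0∞) + 2⁻¹ ≤ 2⁻¹ + μ B := by
    rw [ENNReal.inv_two_add_inv_two]
    exact h1.trans (by gcongr)
  exact (ENNReal.add_le_add_iff_left (by simp)).1 h3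

end Ghost

/-! ### Generalization of empirical risk minimizers -/

section Generalization

variable {X ι : Type*} [MeasurableSpace X] [Fintype ι]

/-- The samples for which some empirical risk minimizer in `H` has error above `b` on `D`. -/
def ermFailure (H : Set (X → Bool)) (D : Measure (X × Bool)) (b : ℝ≥0∞) :
    Set (ι → X × Bool) :=
  {z | ∃ h ∈ H, (∀ h' ∈ H, weight (errPattern h z) ≤ weight (errPattern h' z)) ∧ b < err D h}

theorem log_two_le_log_one_div {ε : ℝ} (hε : 0 < ε) (hε2 : ε ≤ 1 / 2) :
    Real.log 2 ≤ Real.log (1 / ε) := by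
  apply Real.log_le_log two_pos
  rw [le_div_iff₀ hε]
  linarith

/-- Absorbs a growth function bound and a confidence parameter in an exponential tail. -/
theorem const_mul_pow_mul_exp_le {d p : ℕ} {L a C s δ K : ℝ} (hd : 1 ≤ d) (hδ : 0 < δ)
    (hC : 0 < C) (hCδ : δ ≤ C) (ha : 0 < a) (hL : Real.log 2 ≤ L) (hal : Real.log a ≤ p * L)
    (hK : K = p + Real.log (C / δ) / Real.log 2) (hs : K * (d * L) ≤ s) :
    C * (a ^ d * Real.exp (-s)) ≤ δ := by
  have hl2 := Real.log_pos one_lt_two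
  have hd' : (1 : ℝ) ≤ d := by exact_mod_cast hd
  have hL0 : 0 < L := hl2.trans_le hL
  have hlog0 : 0 ≤ Real.log (C / δ) := Real.log_nonneg (by rwa [le_div_iff₀ hδ, one_mul])
  -- The share p of K pays for a ^ d; the remaining share pays for C / δ, because d * L ≥ log 2.
  have h1 : a ^ d ≤ Real.exp (p * (d * L)) := by
    rw [← Real.exp_log ha, ← Real.exp_nat_mul]
    apply Real.exp_le_exp.2
    nlinarith
  have h2 : Real.log (C / δ) ≤ Real.log (C / δ) / Real.log 2 * (d * L) := by
    rw [div_mul_eq_mul_div, le_div_iff₀ hl2]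
    apply mul_le_mul_of_nonneg_left _ hlog0
    nlinarith
  calc C * (a ^ d * Real.exp (-s)) ≤ C * (Real.exp (p * (d * L)) * Real.exp (-s)) := by gcongr
    _ ≤ C * Real.exp (-Real.log (C / δ)) := by
        rw [← Real.exp_add]
        gcongr
        rw [hK, add_mul] at hs
        linarith
    _ = δ := by
        rw [Real.exp_neg, Real.exp_log (by positivity), inv_div]
        field_simp

theorem ae_errPattern_eq_false [Nonempty ι] (Q : ι → Measure (X × Bool))
    [∀ i, IsProbabilityMeasure (Q i)] {f : X → Bool}
    (h0 : err (average Q) f = 0) : ∀ᵐ z ∂Measure.pi Q, ∀ i, errPattern f z i = false := by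
  have h1 : ∀ i, Q i {z | f z.1 ≠ z.2} = 0 := by
    intro i
    simp only [err, average, Measure.smul_apply, Measure.finsetSum_apply, smul_eq_mul,
      mul_eq_zero, ENNReal.inv_eq_zero, ENNReal.natCast_ne_top, false_or] at h0
    exact Finset.sum_eq_zero_iff.1 h0 i (Finset.mem_univ i)
  refine Filter.eventually_all.2 fun i => ?_
  have h2 : ∀ᵐ z ∂Q i, f z.1 = z.2 := by rw [ae_iff]; exact h1 i
  filter_upwards [(measurePreserving_eval Q i).quasiMeasurePreserving.ae h2] with z hz
  simp only [Function.eval] at hz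
  simp [errPattern, hz]

theorem weight_eq_zero {a : ι → Bool} : weight a = 0 ↔ ∀ i, a i = false := by
  simp [weight, Finset.filter_eq_empty_iff]

/-- Almost surely the target makes no error on the sample, so minimizers make none either. A concept
of error above ε that does so should err about m * ε times on a ghost sample, and few swaps put all
these errors on one side. -/
theorem pi_ermFailure_realizable_le {H : Set (X → Bool)} (hH : WellBehaved H) {d : ℕ}
    (hd : 1 ≤ d) (hHd : vcDim H ≤ d) {ε δ : ℝ} (hε : 0 < ε) (hε2 : ε ≤ 1 / 2) (hδ : 0 < δ)
    (hδ1 : δ < 1) (Q : ι → Measure (X × Bool)) [∀ i, IsProbabilityMeasure (Q i)] {f : X → Bool}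
    (hf : f ∈ H) (hQf : err (average Q) f = 0)
    (hm : 6 * (5 + Real.log (2 / δ) / Real.log 2) * (d / ε * Real.log (1 / ε))
      ≤ Fintype.card ι) :
    Measure.pi Q (ermFailure H (average Q) (ENNReal.ofReal ε)) ≤ ENNReal.ofReal δ := by
  classical
  set m := Fintype.card ι with hmdef
  set L := Real.log (1 / ε) with hL
  have hL2 : Real.log 2 ≤ L := log_two_le_log_one_div hε hε2
  have hl2 := Real.log_two_gt_d9
  have hl2p : 0 < Real.log 2 := by linarith
  have hd' : (1 : ℝ) ≤ d := by exact_mod_cast hd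
  have hlog0 : 0 ≤ Real.log (2 / δ) / Real.log 2 :=
    div_nonneg (Real.log_nonneg (by rw [le_div_iff₀ hδ]; linarith)) hl2p.le
  have hs : (5 + Real.log (2 / δ) / Real.log 2) * (d * L) ≤ m * ε / 6 := by
    have := mul_le_mul_of_nonneg_right hm hε.le
    field_simp at this ⊢
    linarith
  have hdL : Real.log 2 ≤ d * L := by nlinarith
  have hmε : 8 ≤ m * ε := by nlinarith
  have hm0 : (0 : ℝ) < m := by
    by_contra h
    nlinarith
  have : Nonempty ι := Fintype.card_pos_iff.1 (by exact_mod_cast hm0)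
  set E : Set (ι → X × Bool) :=
    {z | ∃ h ∈ H, weight (errPattern h z) = 0 ∧ ENNReal.ofReal ε < err (average Q) h} with hE
  have hsub : (ermFailure H (average Q) (ENNReal.ofReal ε) : Set (ι → X × Bool)) ≤ᵐ[Measure.pi Q]
      E := by
    filter_upwards [ae_errPattern_eq_false Q hQf] with z hz
    rintro ⟨h, hh, hmin, hb⟩
    exact ⟨h, hh, Nat.le_zero.1 ((hmin f hf).trans_eq (weight_eq_zero.2 hz)), hb⟩
  refine (measure_mono_ae hsub).trans ?_
  -- With a = ε / 12 the growth function costs exp (m * ε / 6). Against 2 ^ (-(m * ε / 2)) this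
  -- leaves exp (-(m * ε / 6)), since log 2 / 2 > 1 / 3.
  refine (hH.pi_le_of_ghost (R := fun a b => weight a = 0 ∧ (m * ε / 2 : ℝ) ≤ weight b)
    (c := 2 ^ (-(m * ε / 2))) (G := (1 / (ε / 12)) ^ d * Real.exp (ε / 12 * (m + m))) Q ?_
    (by positivity) ?_ ?_).trans ?_
  · intro x
    have := card_traces_le hHd x (a := ε / 12) (by positivity) (by linarith)
    simpa [Fintype.card_sum, hmdef] using this
  · intro a b
    convert card_swaps_consistent_le a b (m * ε / 2)
  · rintro z ⟨h, hh, hz0, hb⟩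
    have he : ε < (err (average Q) h).toReal :=
      (ENNReal.ofReal_lt_iff_lt_toReal hε.le (measure_ne_top _ _)).1 hb
    set e := (err (average Q) h).toReal
    have hme : m * ε ≤ m * e := by gcongr
    have hme0 : 0 < m * e := by linarith
    -- Chebyshev's bound here is 4 / (m * e), at most 1 / 2 because m * e ≥ m * ε ≥ 8.
    refine ⟨h, hh, half_le_pi_of_compl (p := m * e / (m * e / 2) ^ 2) ?_
      (pi_abs_weight_sub_ge_le Q (hH.measurable h hh) (t := m * e / 2) (by positivity)) ?_⟩
    · rw [div_le_div_iff₀ (by positivity) (by positivity)]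
      nlinarith
    · intro z' hz'
      simp only [Set.mem_compl_iff, Set.mem_ofPred_eq, not_le] at hz' ⊢
      refine ⟨hz0, ?_⟩
      have := (abs_lt.1 hz').1
      simp only [← hmdef] at this
      linarith
  · apply ENNReal.ofReal_le_ofReal
    refine le_trans ?_ (const_mul_pow_mul_exp_le (p := 5) (L := L) (a := 12 / ε) (C := 2)
      (s := m * ε / 6) hd hδ two_pos (by linarith) (by positivity) hL2 ?_ rfl (by simpa using hs))
    · rw [one_div_div, mul_assoc]
      gcongr
      rw [Real.rpow_def_of_pos two_pos, ← Real.exp_add]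
      apply Real.exp_le_exp.2
      nlinarith
    · have h16 : Real.log 12 ≤ 4 * Real.log 2 := by
        rw [show (4 : ℝ) = (4 : ℕ) by norm_num, ← Real.log_pow]
        exact Real.log_le_log (by norm_num) (by norm_num)
      rw [div_eq_mul_one_div, Real.log_mul (by norm_num) (by positivity)]
      push_cast
      linarith

/-- If all empirical error counts are within m * ε / 2 of their means, a minimizer is within ε of
every competitor, hence of the infimum. A larger deviation, against a ghost deviation below m * ε /
4, leaves a gap of m * ε / 4 between the two samples. -/
theorem pi_ermFailure_agnostic_le {H : Set (X → Bool)} (hH : WellBehaved H) {d : ℕ}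
    (hd : 1 ≤ d) (hHd : vcDim H ≤ d) {ε δ : ℝ} (hε : 0 < ε) (hε2 : ε ≤ 1 / 2) (hδ : 0 < δ)
    (hδ1 : δ < 1) (Q : ι → Measure (X × Bool)) [∀ i, IsProbabilityMeasure (Q i)]
    (hm : 64 * (9 + Real.log (4 / δ) / Real.log 2) * (d / ε ^ 2 * Real.log (1 / ε))
      ≤ Fintype.card ι) :
    Measure.pi Q (ermFailure H (average Q) (opt H (average Q) + ENNReal.ofReal ε))
      ≤ ENNReal.ofReal δ := by
  classical
  set m := Fintype.card ι with hmdef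
  set L := Real.log (1 / ε) with hL
  have hL2 : Real.log 2 ≤ L := log_two_le_log_one_div hε hε2
  have hl2 := Real.log_two_gt_d9
  have hl2p : 0 < Real.log 2 := by linarith
  have hd' : (1 : ℝ) ≤ d := by exact_mod_cast hd
  have hlog0 : 0 ≤ Real.log (4 / δ) / Real.log 2 :=
    div_nonneg (Real.log_nonneg (by rw [le_div_iff₀ hδ]; linarith)) hl2p.le
  have hs : (9 + Real.log (4 / δ) / Real.log 2) * (d * L) ≤ m * ε ^ 2 / 64 := by
    have := mul_le_mul_of_nonneg_right hm (sq_nonneg ε)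
    field_simp at this ⊢
    linarith
  have hdL : Real.log 2 ≤ d * L := by nlinarith
  have hmε : 32 ≤ m * ε ^ 2 := by nlinarith
  have hm0 : (0 : ℝ) < m := by
    by_contra h
    nlinarith [sq_nonneg ε]
  have : Nonempty ι := Fintype.card_pos_iff.1 (by exact_mod_cast hm0)
  set E : Set (ι → X × Bool) :=
    {z | ∃ h ∈ H, m * ε / 2 <
      |(weight (errPattern h z) : ℝ) - m * (err (average Q) h).toReal|} with hE
  have hsub : (ermFailure H (average Q) (opt H (average Q) + ENNReal.ofReal ε) :
      Set (ι → X × Bool)) ⊆ E := by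
    rintro z ⟨h, hh, hmin, hb⟩
    by_contra hz
    simp only [hE, Set.mem_ofPred_eq, not_exists, not_and, not_lt] at hz
    refine hb.not_ge ?_
    rw [opt, ENNReal.iInf_add]
    refine le_iInf fun h' => ?_
    rw [ENNReal.iInf_add]
    refine le_iInf fun hh' => ?_
    rw [← ENNReal.ofReal_toReal (a := err (average Q) h) (measure_ne_top _ _),
      ← ENNReal.ofReal_toReal (a := err (average Q) h') (measure_ne_top _ _),
      ← ENNReal.ofReal_add ENNReal.toReal_nonneg hε.le]
    apply ENNReal.ofReal_le_ofReal
    have h1 := (abs_le.1 (hz h hh)).1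
    have h2 := (abs_le.1 (hz h' hh')).2
    have h3 : (weight (errPattern h z) : ℝ) ≤ weight (errPattern h' z) := by
      exact_mod_cast hmin h' hh'
    have h4 : m * (err (average Q) h).toReal ≤ m * ((err (average Q) h').toReal + ε) := by
      linarith
    exact le_of_mul_le_mul_left h4 hm0
  refine (measure_mono hsub).trans ?_
  -- The swaps give exp (-(m * ε ^ 2 / 32)); the choice a = ε ^ 2 / 128 spends half of this exponent
  -- on the growth function.
  refine (hH.pi_le_of_ghost (R := fun a b => m * ε / 4 ≤ |(weight a : ℝ) - weight b|)
    (c := 2 * Real.exp (-((m * ε / 4) ^ 2 / (2 * m))))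
    (G := (1 / (ε ^ 2 / 128)) ^ d * Real.exp (ε ^ 2 / 128 * (m + m))) Q ?_
    (by positivity) ?_ ?_).trans ?_
  · intro x
    have := card_traces_le hHd x (a := ε ^ 2 / 128) (by positivity) (by nlinarith)
    simpa [Fintype.card_sum, hmdef] using this
  · intro a b
    convert card_swaps_abs_deviation_le a b (t := m * ε / 4) (by positivity)
  · rintro z ⟨h, hh, hdev⟩
    have he1 : (err (average Q) h).toReal ≤ 1 :=
      ENNReal.toReal_le_of_le_ofReal zero_le_one (by rw [ENNReal.ofReal_one]; exact prob_le_one)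
    set e := (err (average Q) h).toReal
    refine ⟨h, hh, half_le_pi_of_compl (p := m * e / (m * ε / 4) ^ 2) ?_
      (pi_abs_weight_sub_ge_le Q (hH.measurable h hh) (t := m * ε / 4) (by positivity)) ?_⟩
    · rw [div_le_div_iff₀ (by positivity) (by positivity)]
      nlinarith
    · intro z' hz'
      simp only [Set.mem_compl_iff, Set.mem_ofPred_eq, not_le] at hz' ⊢
      simp only [← hmdef] at hz'
      have := abs_sub_abs_le_abs_sub ((weight (errPattern h z) : ℝ) - m * e)
        ((weight (errPattern h z') : ℝ) - m * e)
      rw [sub_sub_sub_cancel_right] at this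
      linarith
  · apply ENNReal.ofReal_le_ofReal
    refine le_trans (le_of_eq ?_) (const_mul_pow_mul_exp_le (p := 9) (L := L) (a := 128 / ε ^ 2)
      (C := 4) (s := m * ε ^ 2 / 64) hd hδ (by norm_num) (by linarith) (by positivity) hL2 ?_ rfl
      (by simpa using hs))
    · have : Real.exp (-(m * ε ^ 2 / 64)) = Real.exp (ε ^ 2 / 128 * (m + m)) *
          Real.exp (-((m * ε / 4) ^ 2 / (2 * m))) := by
        rw [← Real.exp_add]
        congr 1
        field_simp
        ring
      rw [one_div_div, this]
      ring
    · have h128 : Real.log 128 = 7 * Real.log 2 := by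
        rw [show (7 : ℝ) = (7 : ℕ) by norm_num, ← Real.log_pow]
        norm_num
      rw [div_eq_mul_one_div, Real.log_mul (by norm_num) (by positivity), ← one_div_pow,
        Real.log_pow]
      push_cast
      linarith

end Generalization

/-! ### Product measures -/

section Product

variable {Z : Type*} [MeasurableSpace Z]

/-- Used to discard the examples that are drawn but never sent. -/
theorem pi_map_comp_embedding {ι J : Type*} [Fintype ι] [Fintype J] (Q : J → Measure Z)
    [∀ j, IsProbabilityMeasure (Q j)] (φ : ι ↪ J) :
    (Measure.pi Q).map (fun z a => z (φ a)) = Measure.pi fun a => Q (φ a) := by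
  have h1 : ProbabilityTheory.iIndepFun (fun j (z : J → Z) => z j) (Measure.pi Q) :=
    ProbabilityTheory.iIndepFun_pi (X := fun _ => id) fun _ => aemeasurable_id
  have h2 := (h1.precomp φ.injective).map_fun_eq_pi_map
    fun a => (measurable_pi_apply (φ a)).aemeasurable
  rw [h2]
  congr 1
  funext a
  exact (measurePreserving_eval Q (φ a)).map_eq

/-- Drawing independently from the mixture amounts to drawing independently from uniformly random
components. -/
theorem pi_average_eq {k m : ℕ} [NeZero k] (Q : Fin k → Measure Z)
    [∀ i, IsProbabilityMeasure (Q i)] :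
    Measure.pi (fun _ : Fin m => average Q) =
      (Fintype.card (Fin m → Fin k) : ℝ≥0∞)⁻¹ • ∑ r : Fin m → Fin k,
        Measure.pi fun j => Q (r j) := by
  refine Measure.pi_eq fun s hs => ?_
  simp only [average, Measure.smul_apply, Measure.finsetSum_apply, smul_eq_mul, Measure.pi_pi]
  rw [Finset.prod_mul_distrib, Finset.prod_univ_sum, Fintype.piFinset_univ]
  congr 1
  simp only [Finset.prod_const, Finset.card_univ, Fintype.card_fin, Fintype.card_fun,
    Nat.cast_pow, ENNReal.inv_pow]

theorem average_const {ι : Type*} [Fintype ι] [Nonempty ι] (D : Measure Z) :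
    average (fun _ : ι => D) = D := by
  ext s _
  simp only [average, Measure.smul_apply, smul_eq_mul, Finset.sum_const,
    Finset.card_univ, nsmul_eq_mul]
  rw [← mul_assoc, ENNReal.inv_mul_cancel (by simp) (by simp), one_mul]

theorem average_comp_fst {ι J : Type*} [Fintype ι] [Fintype J] [Nonempty J]
    (Q : ι → Measure Z) : average (fun p : ι × J => Q p.1) = average Q := by
  ext s _
  simp only [average, Measure.smul_apply, Measure.finsetSum_apply, smul_eq_mul,
    Fintype.sum_prod_type, Finset.sum_const, Finset.card_univ, nsmul_eq_mul, Fintype.card_prod,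
    Nat.cast_mul]
  rw [← Finset.mul_sum, ENNReal.mul_inv (by simp) (by simp), mul_assoc, ← mul_assoc _ _ (∑ i, _),
    ENNReal.inv_mul_cancel (by simp) (by simp), one_mul]

end Product

/-! ### One-round protocols -/

section OneRound

variable {X : Type*} [MeasurableSpace X] {k : ℕ}

/-- The number of examples of the transcript mispredicted by `h`. -/
def transcriptLoss (h : X → Bool) (τ : Transcript X k) : ℕ :=
  (τ.map fun m => ∑ i, (m i).countP fun z => xor (h z.1) z.2).sum

/-- The loss is a natural number, so a minimizer exists however large H is. -/
theorem exists_minimal_loss {X : Type*} {H : Set (X → Bool)} (hne : H.Nonempty)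
    (τ : Transcript X k) :
    ∃ h ∈ H, ∀ h' ∈ H, transcriptLoss h τ ≤ transcriptLoss h' τ :=
  WellFounded.has_min (measure fun h : X → Bool => transcriptLoss h τ).wf H hne |>.imp
    fun _ hh => ⟨hh.1, fun h' hh' => not_lt.1 (hh.2 h' hh')⟩

open Classical in
/-- The protocol in which the examples in the range of `φ` are sent in one round and an empirical
risk minimizer is computed from them. -/
abbrev ermProtocol (H : Set (X → Bool)) (hH : ∀ h ∈ H, Measurable h) (hne : H.Nonempty) {n : ℕ}
    {ι : Type*} (φ : ι ↪ Fin k × Fin n) : Protocol X k where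
  rounds := 1
  sampleSize := n
  send _ i _ := (Finset.univ.filter fun j => ∃ a, φ a = (i, j)).toList
  output τ := (exists_minimal_loss hne τ).choose
  measurable_output τ := hH _ (exists_minimal_loss hne τ).choose_spec.1

theorem Protocol.transcript_simultaneous_one (P : Protocol X k)
    (z : Fin k → Fin P.sampleSize → X × Bool) :
    P.transcript (Channel.simultaneous k) z 1 = [P.message z []] := by
  simp only [Protocol.transcript, Channel.simultaneous, List.nil_append]
  congr 1
  funext i
  by_cases h : 0 < (P.message z [] i).length
  · exact if_pos (Finset.mem_filter.2 ⟨Finset.mem_univ i, h⟩)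
  -- A player with nothing to send is not among the transmitters, but the default entry `[]` is its
  -- message anyway.
  · refine (if_neg ?_).trans (Eq.symm (a := P.message z [] i) ?_)
    · exact fun h' => h (Finset.mem_filter.1 h').2
    · exact (List.length_eq_zero_iff.1 (Nat.eq_zero_of_not_pos h))

theorem countP_toList {α : Type*} (s : Finset α) (q : α → Bool) :
    s.toList.countP q = (s.filter fun a => q a = true).card := by
  rw [Finset.card_def, Finset.filter_val, ← Multiset.countP_eq_card_filter, ← Finset.coe_toList,
    Multiset.coe_countP]
  simp

open Classical in
theorem sum_card_filter_embedding {n : ℕ} {ι : Type*} [Fintype ι] (φ : ι ↪ Fin k × Fin n)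
    (p : Fin k × Fin n → Prop) [DecidablePred p] :
    ∑ i, (Finset.univ.filter fun j => (∃ a, φ a = (i, j)) ∧ p (i, j)).card =
      (Finset.univ.filter fun a => p (φ a)).card := by
  simp_rw [Finset.card_filter]
  rw [← Fintype.sum_prod_type (f := fun q : Fin k × Fin n =>
    if (∃ a, φ a = q) ∧ p q then 1 else 0), ← Finset.card_filter, ← Finset.card_filter,
    ← Finset.card_map φ]
  congr 1
  ext q
  simp only [Finset.mem_filter, Finset.mem_univ, true_and, Finset.mem_map]
  constructor
  · rintro ⟨⟨a, rfl⟩, h⟩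
    exact ⟨a, h, rfl⟩
  · rintro ⟨a, h, rfl⟩
    exact ⟨⟨a, rfl⟩, h⟩

variable {H : Set (X → Bool)} (hH : ∀ h ∈ H, Measurable h) (hne : H.Nonempty) {n : ℕ}
    {ι : Type*} [Fintype ι] (φ : ι ↪ Fin k × Fin n)

theorem ermProtocol_examplesSent (z : Fin k → Fin n → X × Bool) :
    (ermProtocol H hH hne φ).examplesSent (Channel.simultaneous k) z = Fintype.card ι := by
  classical
  have := sum_card_filter_embedding φ fun _ => True
  simp only [and_true, Finset.filter_true, Finset.card_univ] at this
  unfold Protocol.examplesSent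
  rw [Protocol.transcript_simultaneous_one, ← this]
  simp only [List.map_cons, List.map_nil, List.sum_singleton, Protocol.message, List.length_map,
    ermProtocol, Finset.length_toList]
  refine Finset.sum_congr rfl fun i _ => ?_
  congr

theorem ermProtocol_transcriptLoss (z : Fin k → Fin n → X × Bool) (h : X → Bool) :
    transcriptLoss h ((ermProtocol H hH hne φ).transcript (Channel.simultaneous k) z 1) =
      weight (errPattern h fun a => z (φ a).1 (φ a).2) := by
  classical
  have := sum_card_filter_embedding φ fun q => xor (h (z q.1 q.2).1) (z q.1 q.2).2 = true
  have hw : weight (errPattern h fun a => z (φ a).1 (φ a).2) = (Finset.univ.filter fun a =>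
      xor (h (z (φ a).1 (φ a).2).1) (z (φ a).1 (φ a).2).2 = true).card := by
    unfold weight
    congr 1
  rw [hw, Protocol.transcript_simultaneous_one, transcriptLoss]
  refine Eq.trans ?_ this
  simp only [List.map_cons, List.map_nil, List.sum_singleton, Protocol.message, ermProtocol]
  refine Finset.sum_congr rfl fun i _ => ?_
  rw [List.countP_map, countP_toList, Finset.filter_filter]
  congr 1
  ext j
  simp only [Finset.mem_filter, Function.comp]

theorem ermProtocol_failureProb_le (Q : Fin k → Measure (X × Bool))
    [∀ i, IsProbabilityMeasure (Q i)] (b : ℝ≥0∞) :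
    (ermProtocol H hH hne φ).failureProb (Channel.simultaneous k) Q b ≤
      Measure.pi (fun a => Q (φ a).1) (ermFailure H (mixture Q) b) := by
  have h1 := pi_map_comp_embedding (fun p : Fin k × Fin n => Q p.1) φ
  rw [← h1]
  refine le_trans (measure_mono fun z hz => ?_) (Measure.le_map_apply
    (measurable_pi_lambda _ fun a => measurable_pi_apply (φ a)).aemeasurable _)
  simp only [Set.mem_ofPred_eq] at hz
  set τ := (ermProtocol H hH hne φ).transcript (Channel.simultaneous k) (fun i j => z (i, j)) 1
    with hτ
  refine ⟨_, (exists_minimal_loss hne τ).choose_spec.1, fun h' hh' => ?_, hz⟩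
  have := (exists_minimal_loss hne τ).choose_spec.2 h' hh'
  rw [hτ, ermProtocol_transcriptLoss, ermProtocol_transcriptLoss] at this
  exact this

/-- If empirical risk minimization from `K * B` independent examples whose distributions average
to the mixture works, then it can be carried out in one round. -/
theorem exists_isOneRound {H : Set (X → Bool)} (hH : ∀ h ∈ H, Measurable h) (hne : H.Nonempty)
    [NeZero k] {B K : ℝ} (hB : 1 ≤ B) (hK : 0 < K) :
    ∃ (s : ℕ) (P : Fin s → Protocol X k), IsOneRound P B ((K + 1) * B) ∧
      ∀ (Q : Fin k → Measure (X × Bool)) (b p : ℝ≥0∞), (∀ i, IsProbabilityMeasure (Q i)) →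
        (∀ (ι : Type) [Fintype ι] (Q' : ι → Measure (X × Bool)) [∀ i, IsProbabilityMeasure (Q' i)],
          average Q' = mixture Q → K * B ≤ Fintype.card ι →
          Measure.pi Q' (ermFailure H (mixture Q) b) ≤ p) →
        sharedFailureProb P Q b ≤ p := by
  have hk0 : (0 : ℝ) < k := by exact_mod_cast Nat.pos_of_ne_zero (NeZero.ne k)
  by_cases hk : (k : ℝ) ≤ B
  -- Few players: equal shares. Rounding up costs at most k ≤ B extra examples, whence the factor K
  -- + 1.
  · set n := ⌈K * B / k⌉₊ with hn
    have hn1 : K * B ≤ k * n := by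
      have := Nat.le_ceil (K * B / k)
      rw [div_le_iff₀ hk0] at this
      linarith
    have hn2 : (k * n : ℝ) ≤ (K + 1) * B := by
      have := (Nat.ceil_lt_add_one (a := K * B / k) (by positivity)).le
      rw [← hn] at this
      calc (k * n : ℝ) ≤ k * (K * B / k + 1) := by gcongr
        _ = K * B + k := by field_simp
        _ ≤ _ := by linarith
    have hn0 : NeZero n := ⟨by
      rintro h0
      rw [h0] at hn1
      have : 0 < K * B := by positivity
      simp at hn1
      linarith⟩
    refine ⟨1, fun _ => ermProtocol H hH hne (Function.Embedding.refl (Fin k × Fin n)),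
      ⟨one_pos, fun _ => rfl, fun _ => rfl, fun r z => ?_⟩, fun Q b p hQ hp => ?_⟩
    · rw [ermProtocol_examplesSent]
      simpa using hn2
    · simp only [sharedFailureProb, Nat.cast_one, inv_one, one_mul, Finset.univ_unique,
        Finset.sum_singleton]
      refine (ermProtocol_failureProb_le hH hne _ Q b).trans (hp _ _ ?_ ?_)
      · rw [mixture_eq_average]
        exact average_comp_fst Q
      · simpa using hn1
  · set m := ⌈K * B⌉₊ with hm
    have hm1 : K * B ≤ m := Nat.le_ceil _
    have hm2 : (m : ℝ) ≤ (K + 1) * B := by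
      have := (Nat.ceil_lt_add_one (a := K * B) (by positivity)).le
      linarith
    have hm0 : NeZero m := ⟨by
      rintro h0
      have : 0 < K * B := by positivity
      rw [h0] at hm1
      simp at hm1
      linarith⟩
    -- The string r names the player who supplies the j-th example. That player uses position j of
    -- its own sample, so a player named repeatedly never reuses an example.
    let φ : (Fin m → Fin k) → (Fin m ↪ Fin k × Fin m) := fun r =>
      ⟨fun j => (r j, j), fun _ _ h => congrArg Prod.snd h⟩
    let e := Fintype.equivFin (Fin m → Fin k)
    refine ⟨Fintype.card (Fin m → Fin k), fun r => ermProtocol H hH hne (φ (e.symm r)),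
      ⟨Fintype.card_pos, fun h => absurd h hk, fun _ => rfl, fun r z => ?_⟩,
      fun Q b p hQ hp => ?_⟩
    · rw [ermProtocol_examplesSent]
      simpa using hm2
    · have h1 := hp (Fin m) (fun _ => average Q) (by rw [average_const, mixture_eq_average])
        (by simpa using hm1)
      rw [pi_average_eq, ← measure_toMeasurable] at h1
      refine le_trans ?_ h1
      simp only [Measure.smul_apply, Measure.finsetSum_apply, smul_eq_mul, sharedFailureProb]
      gcongr
      rw [← e.symm.sum_comp]
      gcongr with r
      exact (ermProtocol_failureProb_le hH hne _ Q b).trans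
        (measure_mono (subset_toMeasurable _ _))

end OneRound

/-! ### Classes of VC dimension zero -/

section DimZero

variable {X : Type*} [MeasurableSpace X] {k : ℕ}

/-- Two distinct concepts shatter any point on which they differ. -/
theorem eq_of_vcDim_eq_zero {X : Type*} {H : Set (X → Bool)} (h0 : vcDim H = 0) {h h' : X → Bool}
    (hh : h ∈ H) (hh' : h' ∈ H) : h = h' := by
  by_contra hne
  obtain ⟨x, hx⟩ := Function.ne_iff.1 hne
  have hsh : Shatters H {x} := by
    intro g
    by_cases hg : h x = g x
    · exact ⟨h, hh, by simpa using hg⟩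
    · refine ⟨h', hh', ?_⟩
      simp only [Finset.mem_singleton, forall_eq]
      revert hx hg
      cases h x <;> cases h' x <;> cases g x <;> simp
  have h1 : (((({x} : Finset X)).card : ℕ) : ℕ∞) ≤ vcDim H :=
    le_iSup₂ (f := fun (S : Finset X) (_ : Shatters H S) => (S.card : ℕ∞)) _ hsh
  rw [h0] at h1
  simp at h1

/-- The protocol without communication that always answers `g`. -/
abbrev constProtocol (g : X → Bool) (hg : Measurable g) : Protocol X k where
  rounds := 1
  sampleSize := 0
  send _ _ _ := []
  output _ := g
  measurable_output _ := hg

theorem constProtocol_isOneRound (g : X → Bool) (hg : Measurable g) {B m : ℝ} (hm : 0 ≤ m) :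
    IsOneRound (fun _ : Fin 1 => constProtocol (k := k) g hg) B m := by
  refine ⟨one_pos, fun _ => rfl, fun _ => rfl, fun _ z => ?_⟩
  unfold Protocol.examplesSent
  rw [Protocol.transcript_simultaneous_one]
  simpa [Protocol.message, constProtocol] using hm

theorem constProtocol_sharedFailureProb (g : X → Bool) (hg : Measurable g)
    {Q : Fin k → Measure (X × Bool)} {b : ℝ≥0∞} (hb : err (mixture Q) g ≤ b) :
    sharedFailureProb (fun _ : Fin 1 => constProtocol g hg) Q b = 0 := by
  have : ∀ z : Fin k → Fin 0 → X × Bool, ¬ b < err (mixture Q)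
      ((constProtocol g hg).hypothesis (Channel.simultaneous k) z) := fun z => not_lt.2 hb
  simp only [sharedFailureProb, Protocol.failureProb, Finset.univ_unique, Finset.sum_singleton]
  have h2 : {z : Fin k × Fin (constProtocol (k := k) g hg).sampleSize → X × Bool |
      b < err (mixture Q) ((constProtocol g hg).hypothesis (Channel.simultaneous k)
        fun i j => z (i, j))} = ∅ :=
    Set.eq_empty_of_forall_notMem fun z => this fun i j => z (i, j)
  rw [h2]
  simp

end DimZero

/-! ### Learning in one round -/

section Learning

variable {X : Type*} [MeasurableSpace X]

theorem isProbabilityMeasure_labelledBy {f : X → Bool} (hf : Measurable f) (D : Measure X)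
    [IsProbabilityMeasure D] : IsProbabilityMeasure (labelledBy f D) :=
  Measure.isProbabilityMeasure_map (measurable_id.prodMk hf).aemeasurable

theorem err_labelledBy {f h : X → Bool} (hf : Measurable f) (hh : Measurable h) (D : Measure X) :
    err (labelledBy f D) h = D {x | h x ≠ f x} := by
  rw [err, labelledBy, Measure.map_apply (measurable_id'.prodMk hf) (measurableSet_errSet hh)]
  rfl

theorem err_mixture {k : ℕ} (Q : Fin k → Measure (X × Bool)) (h : X → Bool) :
    err (mixture Q) h = (k : ℝ≥0∞)⁻¹ * ∑ i, err (Q i) h := by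
  simp [err, mixture, Measure.smul_apply, Measure.finsetSum_apply]

theorem err_mixture_labelledBy_self {k : ℕ} {f : X → Bool} (hf : Measurable f)
    (D : Fin k → Measure X) : err (mixture fun i => labelledBy f (D i)) f = 0 := by
  simp [err_mixture, err_labelledBy hf hf]

theorem nonempty_of_vcDim_ne_zero {X : Type*} {H : Set (X → Bool)} (h : vcDim H ≠ 0) : H.Nonempty := by
  rw [Set.nonempty_iff_ne_empty]
  rintro rfl
  exact h (by simp [vcDim, Shatters])

theorem one_le_budget {d p : ℕ} {ε : ℝ} (hd : d ≠ 0) (hp : p ≠ 0) (hε : 0 < ε)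
    (hε2 : ε ≤ 1 / 2) : 1 ≤ d / ε ^ p * Real.log (1 / ε) := by
  have h1 := log_two_le_log_one_div hε hε2
  have h2 := Real.log_two_gt_d9
  have h3 : (1 : ℝ) ≤ d := by exact_mod_cast Nat.one_le_iff_ne_zero.2 hd
  have h4 : ε ^ p ≤ 1 / 2 := (pow_le_of_le_one hε.le (by linarith) hp).trans hε2
  have h5 : 2 ≤ d / ε ^ p := by
    rw [le_div_iff₀ (by positivity)]
    linarith
  nlinarith

theorem one_round_realizable {δ : ℝ} (hδ : 0 < δ) (hδ1 : δ < 1) (H : Set (X → Bool)) (d k : ℕ)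
    (ε : ℝ) (hH : WellBehaved H) (hd : vcDim H = d) (hk : 0 < k) (hε : 0 < ε)
    (hε2 : ε ≤ 1 / 2) :
    ∃ (s : ℕ) (P : Fin s → Protocol X k),
      IsOneRound P (d / ε * Real.log (1 / ε))
        ((6 * (5 + Real.log (2 / δ) / Real.log 2) + 1) * (d / ε * Real.log (1 / ε))) ∧
      ∀ (D : Fin k → Measure X) (f : X → Bool), (∀ i, IsProbabilityMeasure (D i)) → f ∈ H →
        sharedFailureProb P (fun i => labelledBy f (D i)) (ENNReal.ofReal ε)
          ≤ ENNReal.ofReal δ := by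
  -- For d = 0 the budget is zero, but then H has at most one member and no communication is needed.
  rcases eq_or_ne d 0 with rfl | hd0
  · by_cases hne : H.Nonempty
    · obtain ⟨g, hg⟩ := hne
      refine ⟨1, _, constProtocol_isOneRound g (hH.measurable g hg) (by simp), ?_⟩
      intro D f _ hf
      obtain rfl := eq_of_vcDim_eq_zero (by simpa using hd) hg hf
      rw [constProtocol_sharedFailureProb]
      · exact zero_le
      · rw [err_mixture_labelledBy_self (hH.measurable g hg)]
        exact zero_le
    · exact ⟨1, _, constProtocol_isOneRound (fun _ => false) measurable_const (by simp),
        fun D f _ hf => absurd ⟨f, hf⟩ hne⟩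
  · have : NeZero k := ⟨hk.ne'⟩
    have hl0 : 0 ≤ Real.log (2 / δ) / Real.log 2 := div_nonneg
      (Real.log_nonneg (by rw [le_div_iff₀ hδ]; linarith)) (Real.log_pos one_lt_two).le
    have hB : 1 ≤ d / ε * Real.log (1 / ε) := by
      simpa using one_le_budget hd0 one_ne_zero hε hε2
    obtain ⟨s, P, hP, h⟩ := exists_isOneRound (k := k) hH.measurable
      (nonempty_of_vcDim_ne_zero (by rw [hd]; exact_mod_cast hd0)) hB
      (K := 6 * (5 + Real.log (2 / δ) / Real.log 2)) (by positivity)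
    refine ⟨s, P, hP, fun D f hD hf => h _ _ _
      (fun i => isProbabilityMeasure_labelledBy (hH.measurable f hf) _) fun ι _ Q' _ hav hm => ?_⟩
    rw [← hav]
    refine pi_ermFailure_realizable_le hH (Nat.one_le_iff_ne_zero.2 hd0) hd.le hε hε2 hδ hδ1 Q' hf
      ?_ hm
    rw [hav, err_mixture_labelledBy_self (hH.measurable f hf)]

theorem one_round_agnostic {δ : ℝ} (hδ : 0 < δ) (hδ1 : δ < 1) (H : Set (X → Bool)) (d k : ℕ)
    (ε : ℝ) (hH : WellBehaved H) (hd : vcDim H = d) (hk : 0 < k) (hε : 0 < ε)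
    (hε2 : ε ≤ 1 / 2) :
    ∃ (s : ℕ) (P : Fin s → Protocol X k),
      IsOneRound P (d / ε ^ 2 * Real.log (1 / ε))
        ((64 * (9 + Real.log (4 / δ) / Real.log 2) + 1) * (d / ε ^ 2 * Real.log (1 / ε))) ∧
      ∀ Q : Fin k → Measure (X × Bool), (∀ i, IsProbabilityMeasure (Q i)) →
        sharedFailureProb P Q (opt H (mixture Q) + ENNReal.ofReal ε) ≤ ENNReal.ofReal δ := by
  rcases eq_or_ne d 0 with rfl | hd0
  · by_cases hne : H.Nonempty
    · obtain ⟨g, hg⟩ := hne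
      refine ⟨1, _, constProtocol_isOneRound g (hH.measurable g hg) (by simp), ?_⟩
      intro Q _
      rw [constProtocol_sharedFailureProb]
      · exact zero_le
      · refine le_add_right (le_iInf₂ fun h hh => ?_)
        rw [eq_of_vcDim_eq_zero (by simpa using hd) hg hh]
    · refine ⟨1, _, constProtocol_isOneRound (fun _ => false) measurable_const (by simp), ?_⟩
      intro Q _
      rw [constProtocol_sharedFailureProb]
      · exact zero_le
      -- The infimum over the empty class is ∞, so no hypothesis fails.
      · rw [Set.not_nonempty_iff_eq_empty] at hne
        simp [opt, hne]
  · have : NeZero k := ⟨hk.ne'⟩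
    have hl0 : 0 ≤ Real.log (4 / δ) / Real.log 2 := div_nonneg
      (Real.log_nonneg (by rw [le_div_iff₀ hδ]; linarith)) (Real.log_pos one_lt_two).le
    obtain ⟨s, P, hP, h⟩ := exists_isOneRound (k := k) hH.measurable
      (nonempty_of_vcDim_ne_zero (by rw [hd]; exact_mod_cast hd0))
      (one_le_budget hd0 two_ne_zero hε hε2)
      (K := 64 * (9 + Real.log (4 / δ) / Real.log 2)) (by positivity)
    refine ⟨s, P, hP, fun Q hQ => h _ _ _ hQ fun ι _ Q' _ hav hm => ?_⟩
    rw [← hav]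
    exact pi_ermFailure_agnostic_le hH (Nat.one_le_iff_ne_zero.2 hd0) hd.le hε hε2 hδ hδ1 Q' hm

end Learning

/-! ### Online learners as distributed protocols -/

section Online

variable {X : Type*} [MeasurableSpace X] {k : ℕ}

/-- The predictor of an online learner after the examples of a list. -/
def OnlineAlgorithm.after (A : OnlineAlgorithm X) (l : List (X × Bool)) : X → Bool :=
  A.predict l.length l.get

theorem OnlineAlgorithm.after_eq (A : OnlineAlgorithm X) {l : List (X × Bool)} {n : ℕ}
    (w : Fin n → X × Bool) (hn : l.length = n) (hw : ∀ (i : ℕ) (hi : i < l.length),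
      l[i] = w ⟨i, hn ▸ hi⟩) : A.after l = A.predict n w := by
  subst hn
  rw [OnlineAlgorithm.after]
  congr 1
  funext i
  exact hw i i.2

theorem OnlineAlgorithm.measurable_predict_apply (A : OnlineAlgorithm X) (n : ℕ)
    (w : Fin n → X × Bool) : Measurable (A.predict n w) :=
  (A.measurable_predict n).comp measurable_prodMk_left

/-- Each example of the list is mispredicted after its predecessors. -/
inductive OnlineAlgorithm.IsMistakeSeq (A : OnlineAlgorithm X) : List (X × Bool) → Prop
  | nil : A.IsMistakeSeq []
  | snoc (l : List (X × Bool)) (e : X × Bool) :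
      A.IsMistakeSeq l → A.after l e.1 ≠ e.2 → A.IsMistakeSeq (l ++ [e])

theorem OnlineAlgorithm.IsMistakeSeq.mistakes_eq {A : OnlineAlgorithm X} {l : List (X × Bool)}
    (hl : A.IsMistakeSeq l) {f : X → Bool} (hf : ∀ e ∈ l, e.2 = f e.1) (x : ℕ → X)
    (hx : ∀ (i : ℕ) (hi : i < l.length), x i = l[i].1) : A.mistakes f l.length x = l.length := by
  induction hl with
  | nil => simp [OnlineAlgorithm.mistakes]
  | snoc l e hl he ih =>
    have h1 := ih (fun e' he' => hf e' (List.mem_append_left _ he')) fun i hi => by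
      rw [hx i (by simp; omega), List.getElem_append_left hi]
    have hxe : x l.length = e.1 := by
      rw [hx l.length (by simp)]
      simp
    have h2 : A.after l = A.predict l.length fun s : Fin l.length => (x s, f (x s)) := by
      refine A.after_eq _ rfl fun i hi => ?_
      have h3 : x i = l[i].1 := by
        rw [hx i (by simp; omega), List.getElem_append_left hi]
      rw [h3, ← hf _ (List.mem_append_left _ (List.getElem_mem hi))]
    rw [OnlineAlgorithm.mistakes] at h1 ⊢
    rw [List.length_append, List.length_singleton, Finset.range_add_one, Finset.filter_insert,
      if_pos, Finset.card_insert_of_notMem (by simp), h1]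
    rw [← h2, hxe, ← hf e (by simp)]
    exact he

/-- When the labels come from f, presenting the list to the learner produces a mistake at every
step. -/
theorem OnlineAlgorithm.IsMistakeSeq.length_le {A : OnlineAlgorithm X} {l : List (X × Bool)}
    (hl : A.IsMistakeSeq l) {H : Set (X → Bool)} {M : ℕ} (hM : A.mistakeBound H ≤ M)
    {f : X → Bool} (hfH : f ∈ H) (hf : ∀ e ∈ l, e.2 = f e.1) : l.length ≤ M := by
  rcases l.eq_nil_or_concat with rfl | ⟨l', e, rfl⟩
  · simp
  · set l := l'.concat e
    -- The mistake count is defined for infinite sequences. The tail is filled with the last point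
    -- of the list, which is why the empty list is treated apart: X may be empty.
    let x : ℕ → X := fun i => (l.getD i e).1
    have h1 := hl.mistakes_eq hf x fun i hi => by simp [x, hi]
    have h2 : (A.mistakes f l.length x : ℕ∞) ≤ A.mistakeBound H :=
      (le_iSup₂ (f := fun (T : ℕ) (x : ℕ → X) => (A.mistakes f T x : ℕ∞)) l.length x).trans
        (le_iSup₂ (f := fun (f : X → Bool) (_ : f ∈ H) =>
          ⨆ (T : ℕ) (x : ℕ → X), (A.mistakes f T x : ℕ∞)) f hfH)
    rw [h1] at h2
    exact_mod_cast h2.trans hM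

/-- All the examples of a transcript in the order of transmission. -/
def received (τ : Transcript X k) : List (X × Bool) :=
  τ.flatMap fun m => (List.finRange k).flatMap m

open Classical in
/-- The protocol that runs an online learner on the examples transmitted: a player that holds an
example mispredicted by the current hypothesis tries to send it. -/
abbrev onlineProtocol (A : OnlineAlgorithm X) (k M N : ℕ) : Protocol X k where
  rounds := M
  sampleSize := N
  send τ _ z := if h : ∃ j, A.after (received τ) (z j).1 ≠ (z j).2 then [h.choose] else []
  output τ := A.after (received τ)
  measurable_output _ := A.measurable_predict_apply _ _

theorem flatMap_ite_eq {α β : Type*} [DecidableEq α] {L : List α} (hL : L.Nodup) {i : α}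
    (hi : i ∈ L) (l : List β) : (L.flatMap fun j => if j = i then l else []) = l := by
  induction L with
  | nil => simp at hi
  | cons a L ih =>
    rw [List.nodup_cons] at hL
    rw [List.flatMap_cons]
    by_cases ha : a = i
    · subst ha
      have : (L.flatMap fun j => if j = a then l else []) = [] := by
        rw [List.flatMap_eq_nil_iff]
        intro j hj
        rw [if_neg]
        rintro rfl
        exact hL.1 hj
      simp [this]
    · rw [if_neg ha, ih hL.2 ((List.mem_cons.1 hi).resolve_left (Ne.symm ha)), List.nil_append]

variable (A : OnlineAlgorithm X) (M N : ℕ) {c : Channel k}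

theorem onlineProtocol_message (z : Fin k → Fin N → X × Bool) (τ : Transcript X k) (i : Fin k) :
    (onlineProtocol A k M N).message z τ i = [] ∧
        (∀ j, A.after (received τ) (z i j).1 = (z i j).2) ∨
      ∃ j, (onlineProtocol A k M N).message z τ i = [z i j] ∧
        A.after (received τ) (z i j).1 ≠ (z i j).2 := by
  by_cases h : ∃ j, A.after (received τ) (z i j).1 ≠ (z i j).2
  · refine .inr ⟨h.choose, ?_, h.choose_spec⟩
    simp only [Protocol.message]
    rw [dif_pos h]
    rfl
  · refine .inl ⟨?_, fun j => not_not.1 fun hj => h ⟨j, hj⟩⟩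
    simp only [Protocol.message]
    rw [dif_neg h]
    rfl

/-- One round on the lock-synchronous channel: either all samples are consistent with the current
hypothesis and nothing is sent, or a single mispredicted example is. -/
theorem onlineProtocol_round (hc : c.IsLockSynchronous) (z : Fin k → Fin N → X × Bool) (t : ℕ) :
    ∃ m : Fin k → List (X × Bool),
      (onlineProtocol A k M N).transcript c z (t + 1) =
        (onlineProtocol A k M N).transcript c z t ++ [m] ∧
      (((∀ i, m i = []) ∧ ∀ i j, A.after (received ((onlineProtocol A k M N).transcript c z t))
          (z i j).1 = (z i j).2) ∨
        ∃ i j, (m = fun i' => if i' = i then [z i j] else []) ∧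
          A.after (received ((onlineProtocol A k M N).transcript c z t)) (z i j).1 ≠
            (z i j).2) := by
  refine ⟨_, rfl, ?_⟩
  set τ := (onlineProtocol A k M N).transcript c z t with hτ
  by_cases hS : (Finset.univ.filter fun j =>
      0 < ((onlineProtocol A k M N).message z τ j).length).Nonempty
  · right
    obtain ⟨i, hi, hci⟩ := hc t _ hS
    rcases onlineProtocol_message A M N z τ i with ⟨h, -⟩ | ⟨j, hj, hne⟩
    · have := (Finset.mem_filter.1 hi).2
      rw [h] at this
      simp at this
    · refine ⟨i, j, ?_, hne⟩
      funext i'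
      simp only [hci, Finset.mem_singleton]
      split_ifs with h
      · rw [h, hj]
      · rfl
  · left
    have hnil : ∀ i, (onlineProtocol A k M N).message z τ i = [] := by
      intro i
      by_contra h
      exact hS ⟨i, Finset.mem_filter.2 ⟨Finset.mem_univ i, List.length_pos_iff.2 h⟩⟩
    refine ⟨fun i => ?_, fun i j => ?_⟩
    · rw [hnil, ite_self]
    · rcases onlineProtocol_message A M N z τ i with ⟨-, h⟩ | ⟨j, hj, -⟩
      · exact h j
      · rw [hnil] at hj
        simp at hj

theorem onlineProtocol_examplesSent_le (hc : c.IsLockSynchronous) (z : Fin k → Fin N → X × Bool) :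
    (onlineProtocol A k M N).examplesSent c z ≤ M := by
  have key : ∀ t, (((onlineProtocol A k M N).transcript c z t).map
      fun m => ∑ i, (m i).length).sum ≤ t := by
    intro t
    induction t with
    | zero => simp [Protocol.transcript]
    | succ t ih =>
      obtain ⟨m, hm, h⟩ := onlineProtocol_round A M N hc z t
      rw [hm, List.map_append, List.sum_append, List.map_singleton, List.sum_singleton]
      refine Nat.add_le_add ih ?_
      rcases h with ⟨h, -⟩ | ⟨i, j, rfl, -⟩
      · simp [h]
      · simp [apply_ite List.length]
  exact key M

/-- The examples received are a mistake sequence taken from the samples, and it is as long as the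
number of rounds unless all samples are consistent with the current hypothesis. -/
theorem onlineProtocol_invariant (hc : c.IsLockSynchronous) (z : Fin k → Fin N → X × Bool)
    (t : ℕ) : ∃ l : List (Fin k × Fin N),
      received ((onlineProtocol A k M N).transcript c z t) = l.map (fun p => z p.1 p.2) ∧
      A.IsMistakeSeq (l.map fun p => z p.1 p.2) ∧ l.length ≤ t ∧
      (l.length < t → ∀ i j, A.after (l.map fun p => z p.1 p.2) (z i j).1 = (z i j).2) := by
  induction t with
  | zero => exact ⟨[], by simp [Protocol.transcript, received], .nil, le_rfl, by simp⟩
  | succ t ih =>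
    obtain ⟨l, hl, hmist, hlen, hcons⟩ := ih
    obtain ⟨m, hm, h⟩ := onlineProtocol_round A M N hc z t
    rw [hl] at h
    have hrec : received ((onlineProtocol A k M N).transcript c z (t + 1)) =
        l.map (fun p => z p.1 p.2) ++ (List.finRange k).flatMap m := by
      rw [hm, received, List.flatMap_append, ← received, hl, List.flatMap_singleton]
    rcases h with ⟨h0, hcons'⟩ | ⟨i, j, rfl, hne⟩
    · refine ⟨l, ?_, hmist, by omega, fun _ => hcons'⟩
      rw [hrec, List.flatMap_eq_nil_iff.2 fun i _ => h0 i, List.append_nil]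
    · refine ⟨l ++ [(i, j)], ?_, ?_, ?_, ?_⟩
      · rw [hrec, flatMap_ite_eq (List.nodup_finRange k) (List.mem_finRange i), List.map_append,
          List.map_singleton]
      · rw [List.map_append, List.map_singleton]
        exact .snoc _ _ hmist hne
      · simpa using hlen
      -- After a silent round the hypothesis is consistent with all samples, so no later round can
      -- deliver an example.
      · intro hlt
        rw [List.length_append, List.length_singleton] at hlt
        exact absurd (hcons (by omega) i j) hne

end Online

/-! ### Generalization by compression -/

section Compression

variable {X : Type*} [MeasurableSpace X]

/-- A hypothesis computed from the examples with indices in `R` is tested on the others. -/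
theorem pi_consistent_le {J : Type*} [Fintype J] [DecidableEq J]
    (Q : J → Measure (X × Bool)) [∀ p, IsProbabilityMeasure (Q p)] (D : Measure (X × Bool)) [IsProbabilityMeasure D]
    (R : Finset J) (g : (R → X × Bool) → X → Bool)
    (hg : Measurable fun p : (R → X × Bool) × X => g p.1 p.2) {b a : ℝ≥0∞}
    (ha : ∀ h : X → Bool, Measurable h → b < err D h →
      ∏ p : {p // p ∉ R}, Q p {z | h z.1 = z.2} ≤ a) :
    Measure.pi Q {z | b < err D (g fun p => z p) ∧
      ∀ p, p ∉ R → g (fun p => z p) (z p).1 = (z p).2} ≤ a := by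
  classical
  have he := measurePreserving_piEquivPiSubtypeProd Q (· ∈ R)
  set F : Set ((R → X × Bool) × ({p // p ∉ R} → X × Bool)) :=
    {w | b < err D (g w.1) ∧ ∀ p, g w.1 (w.2 p).1 = (w.2 p).2} with hF
  have hgz : Measurable fun w : (R → X × Bool) × (X × Bool) => g w.1 w.2.1 :=
    hg.comp (by fun_prop : Measurable fun w : (R → X × Bool) × (X × Bool) => (w.1, w.2.1))
  have herr : Measurable fun u : R → X × Bool => err D (g u) := by
    have hS : MeasurableSet {w : (R → X × Bool) × (X × Bool) | g w.1 w.2.1 ≠ w.2.2} :=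
      (measurableSet_eq_fun hgz (by fun_prop)).compl
    exact measurable_measure_prodMk_left hS
  have hFm : MeasurableSet F := by
    have h1 : F = {w | b < err D (g w.1)} ∩ ⋂ p, {w | g w.1 (w.2 p).1 = (w.2 p).2} := by
      ext w
      simp [hF]
    rw [h1]
    refine (measurableSet_lt measurable_const (herr.comp measurable_fst)).inter
      (MeasurableSet.iInter fun p => measurableSet_eq_fun ?_ (by fun_prop))
    exact hg.comp (by fun_prop : Measurable fun w : (R → X × Bool) × ({p // p ∉ R} → X × Bool) =>
      (w.1, (w.2 p).1))
  have hpre : {z : J → X × Bool | b < err D (g fun p => z p) ∧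
      ∀ p, p ∉ R → g (fun p => z p) (z p).1 = (z p).2} =
      MeasurableEquiv.piEquivPiSubtypeProd (fun _ => X × Bool) (· ∈ R) ⁻¹' F := by
    ext z
    simp only [hF, Set.mem_ofPred_eq, Set.mem_preimage]
    exact and_congr_right fun _ => ⟨fun h p => h p.1 p.2, fun h p hp => h ⟨p, hp⟩⟩
  rw [hpre, he.measure_preimage hFm.nullMeasurableSet]
  rw [Measure.prod_apply hFm]
  -- Once the examples in R are fixed, so is the hypothesis, and the remaining examples are
  -- independent tests of it.
  refine (lintegral_mono (g := fun _ => a) fun u => ?_).trans_eq (by simp)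
  by_cases hb : b < err D (g u)
  · refine le_trans (measure_mono fun v hv => ?_)
      ((Measure.pi_pi _ fun _ => {z | g u z.1 = z.2}).trans_le
        (ha (g u) (hg.comp measurable_prodMk_left) hb))
    exact fun p _ => hv.2 p
  · have : Prod.mk u ⁻¹' F = ∅ := Set.eq_empty_of_forall_notMem fun v hv => hb hv.1
    rw [this]
    simp

theorem measure_correct_le {Q : Measure (X × Bool)} [IsProbabilityMeasure Q] {h : X → Bool}
    (hh : Measurable h) {b : ℝ≥0∞} (hb : b ≤ err Q h) : Q {z | h z.1 = z.2} ≤ 1 - b := by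
  have h1 := prob_compl_eq_one_sub (μ := Q) (measurableSet_errSet hh)
  have h2 : {z : X × Bool | h z.1 ≠ z.2}ᶜ = {z | h z.1 = z.2} := by
    ext z
    simp
  rw [← h2, h1]
  exact tsub_le_tsub_left hb 1

theorem exists_lt_err_of_lt_mixture {k : ℕ} [NeZero k] {Q : Fin k → Measure (X × Bool)}
    {h : X → Bool} {b : ℝ≥0∞} (hb : b < err (mixture Q) h) : ∃ i, b < err (Q i) h := by
  by_contra! hle
  refine hb.not_ge ?_
  rw [err_mixture]
  calc (k : ℝ≥0∞)⁻¹ * ∑ i, err (Q i) h ≤ (k : ℝ≥0∞)⁻¹ * ∑ _i : Fin k, b := by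
        gcongr with i
        exact hle i
    _ = b := by
        rw [Finset.sum_const, Finset.card_univ, Fintype.card_fin, nsmul_eq_mul, ← mul_assoc,
          ENNReal.inv_mul_cancel (by simp [NeZero.ne k]) (by simp), one_mul]

/-- If the mixture error exceeds b, so does the error for some player. At least N - M examples of
that player lie outside R; the other factors are bounded by 1. -/
theorem prod_correct_le {k N : ℕ} [NeZero k] (Q : Fin k → Measure (X × Bool))
    [∀ i, IsProbabilityMeasure (Q i)] (R : Finset (Fin k × Fin N)) {M : ℕ} (hR : R.card ≤ M)
    {h : X → Bool} (hh : Measurable h) {b : ℝ≥0∞} (hb : b < err (mixture Q) h) :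
    ∏ p : {p // p ∉ R}, Q p.1.1 {z | h z.1 = z.2} ≤ (1 - b) ^ (N - M) := by
  obtain ⟨i, hi⟩ := exists_lt_err_of_lt_mixture hb
  calc ∏ p : {p // p ∉ R}, Q p.1.1 {z | h z.1 = z.2}
      = ∏ p ∈ Rᶜ, Q p.1 {z | h z.1 = z.2} :=
        (Finset.prod_subtype Rᶜ (fun p => by simp)
          fun p : Fin k × Fin N => Q p.1 {z | h z.1 = z.2}).symm
    _ ≤ ∏ p ∈ Rᶜ, if p.1 = i then 1 - b else 1 := by
        refine Finset.prod_le_prod' fun p _ => ?_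
        split_ifs with hp
        · rw [hp]
          exact measure_correct_le hh hi.le
        · exact prob_le_one
    _ = (1 - b) ^ (Rᶜ.filter fun p => p.1 = i).card := by
        rw [← Finset.prod_filter, Finset.prod_const]
    _ ≤ (1 - b) ^ (N - M) := by
        refine pow_le_pow_right_of_le_one' tsub_le_self ?_
        have h1 : (Rᶜ.filter fun p => p.1 = i) = (({i} : Finset (Fin k)) ×ˢ Finset.univ) \ R := by
          ext ⟨i', j⟩
          simp only [Finset.mem_filter, Finset.mem_compl, Finset.mem_sdiff, Finset.mem_product,
            Finset.mem_singleton, Finset.mem_univ, and_true]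
          exact and_comm
        have h2 := Finset.le_card_sdiff R (({i} : Finset (Fin k)) ×ˢ (Finset.univ : Finset (Fin N)))
        rw [← h1, Finset.card_product, Finset.card_singleton, Finset.card_univ, Fintype.card_fin,
          one_mul] at h2
        omega

theorem exists_sampleSize (k M : ℕ) {ε δ : ℝ} (hε : 0 < ε) (hδ : 0 < δ) :
    ∃ N : ℕ, 0 < N ∧ (M : ℝ≥0∞) * ((k * N : ℕ) : ℝ≥0∞) ^ M * (1 - ENNReal.ofReal ε) ^ (N - M) ≤
      ENNReal.ofReal δ := by
  -- ε may exceed 1, and subtraction in `ℝ≥0∞` truncates at 0.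
  set r := max (1 - ε) 0 with hr
  have hr0 : 0 ≤ r := le_max_right _ _
  have hr1 : |r| < 1 := by
    rw [abs_of_nonneg hr0]
    exact max_lt (by linarith) one_pos
  have hlim := (tendsto_pow_const_mul_const_pow_of_abs_lt_one M hr1).const_mul
    ((M : ℝ) * (k * (M + 1)) ^ M)
  rw [mul_zero] at hlim
  obtain ⟨n, hn, hn1⟩ := ((hlim.eventually_lt_const hδ).and
    (Filter.eventually_ge_atTop 1)).exists
  -- This makes N - M equal to n, and n + M ≤ (M + 1) * n for n ≥ 1, so a polynomial in n competes
  -- with r ^ n.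
  refine ⟨n + M, by omega, ?_⟩
  have h1 : (1 - ENNReal.ofReal ε) = ENNReal.ofReal r := by
    rw [← ENNReal.ofReal_one, ← ENNReal.ofReal_sub _ hε.le, hr, ENNReal.ofReal_max,
      ENNReal.ofReal_zero, max_eq_left zero_le]
  rw [h1, Nat.add_sub_cancel, ← ENNReal.ofReal_natCast M, ← ENNReal.ofReal_natCast,
    ← ENNReal.ofReal_pow (by positivity), ← ENNReal.ofReal_pow hr0,
    ← ENNReal.ofReal_mul (by positivity), ← ENNReal.ofReal_mul (by positivity)]
  apply ENNReal.ofReal_le_ofReal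
  refine le_trans ?_ hn.le
  have h2 : ((k * (n + M) : ℕ) : ℝ) ≤ k * (M + 1) * n := by
    have : (1 : ℝ) ≤ n := by exact_mod_cast hn1
    push_cast
    rw [mul_assoc]
    gcongr
    nlinarith [Nat.cast_nonneg (α := ℝ) M]
  calc (M : ℝ) * ((k * (n + M) : ℕ) : ℝ) ^ M * r ^ n
      ≤ M * (k * (M + 1) * n) ^ M * r ^ n := by gcongr
    _ = _ := by rw [mul_pow]; ring

end Compression

/-! ### Failure probability of the online protocol, and the mistake-bound theorem -/

section MistakeBound

variable {X : Type*} [MeasurableSpace X]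

theorem ae_label_eq {J : Type*} [Fintype J] {f : X → Bool} (hf : Measurable f)
    (D : J → Measure X) [∀ p, IsProbabilityMeasure (D p)] :
    ∀ᵐ z ∂Measure.pi fun p => labelledBy f (D p), ∀ p, (z p).2 = f (z p).1 := by
  have := fun p => isProbabilityMeasure_labelledBy hf (D p)
  refine Filter.eventually_all.2 fun p => ?_
  have h2 : ∀ᵐ z ∂labelledBy f (D p), f z.1 = z.2 := by
    rw [ae_iff]
    exact (err_labelledBy hf hf (D p)).trans (by simp)
  filter_upwards [(measurePreserving_eval (fun p => labelledBy f (D p)) p).quasiMeasurePreserving.ae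
    h2] with z hz
  exact hz.symm

theorem onlineProtocol_failureProb_le {H : Set (X → Bool)} (hH : ∀ h ∈ H, Measurable h)
    {A : OnlineAlgorithm X} {M : ℕ} (hA : A.mistakeBound H ≤ M) {k N : ℕ} [NeZero k]
    (hN : 0 < N) {c : Channel k} (hc : c.IsLockSynchronous) (D : Fin k → Measure X)
    [∀ i, IsProbabilityMeasure (D i)] {f : X → Bool} (hf : f ∈ H) (b : ℝ≥0∞) :
    (onlineProtocol A k M N).failureProb c (fun i => labelledBy f (D i)) b ≤
      M * ((k * N : ℕ) : ℝ≥0∞) ^ M * (1 - b) ^ (N - M) := by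
  have hQ := fun i => isProbabilityMeasure_labelledBy (hH f hf) (D i)
  set Q := fun i => labelledBy f (D i) with hQdef
  have hprob : IsProbabilityMeasure (mixture Q) := by
    rw [mixture_eq_average]
    infer_instance
  -- The tuple q is fixed before the data are seen. This removes the adaptive choice of examples and
  -- the dependence on the channel, at the price of a union bound.
  let B : (n : ℕ) → (Fin n → Fin k × Fin N) → Set (Fin k × Fin N → X × Bool) := fun n q =>
    {z | b < err (mixture Q) (A.predict n fun i => z (q i)) ∧
      ∀ p, p ∉ Finset.univ.image q → A.predict n (fun i => z (q i)) (z p).1 = (z p).2}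
  have hsub : {z | b < err (mixture Q) ((onlineProtocol A k M N).hypothesis c
      fun i j => z (i, j))} ≤ᵐ[Measure.pi fun p : Fin k × Fin N => Q p.1]
      ⋃ n ∈ Finset.range M, ⋃ q : Fin n → Fin k × Fin N, B n q := by
    filter_upwards [ae_label_eq (hH f hf) fun p : Fin k × Fin N => D p.1] with z hz hb
    obtain ⟨l, hl, hmist, hlen, hcons⟩ :=
      onlineProtocol_invariant A M N hc (fun i j => z (i, j)) M
    have hb' : b < err (mixture Q) (A.after (l.map z)) := by
      have : (onlineProtocol A k M N).hypothesis c (fun i j => z (i, j)) = A.after (l.map z) := by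
        rw [Protocol.hypothesis]
        exact congrArg A.after hl
      rw [← this]
      exact hb
    have hlab : ∀ e ∈ l.map z, e.2 = f e.1 := by
      intro e he
      obtain ⟨p, -, rfl⟩ := List.mem_map.1 he
      exact hz p
    rcases hlen.lt_or_eq with hlt | heq
    · refine Set.mem_biUnion (Finset.mem_range.2 hlt) (Set.mem_iUnion.2 ⟨l.get, ?_⟩)
      have hafter : A.after (l.map z) = A.predict l.length fun i => z (l.get i) :=
        A.after_eq _ (List.length_map _) fun i hi => by simp
      refine ⟨hafter ▸ hb', fun p _ => ?_⟩
      rw [← hafter]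
      exact hcons hlt p.1 p.2
    -- All M mistakes have been made: a point where the hypothesis differs from f would extend the
    -- mistake sequence to length M + 1. So the hypothesis is f and has error 0.
    · exfalso
      have heqf : A.after (l.map z) = f := by
        funext x
        by_contra hx
        have hle := (hmist.snoc _ (x, f x) hx).length_le hA hf fun e he => by
          rcases List.mem_append.1 he with he | he
          · exact hlab e he
          · rw [List.mem_singleton.1 he]
        rw [List.length_append, List.length_map, List.length_singleton] at hle
        omega
      rw [heqf, err_mixture_labelledBy_self (hH f hf)] at hb'
      exact not_lt_zero hb'
  have hB : ∀ n ∈ Finset.range M, ∀ q : Fin n → Fin k × Fin N,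
      Measure.pi (fun p : Fin k × Fin N => Q p.1) (B n q) ≤ (1 - b) ^ (N - M) := by
    intro n hn q
    refine pi_consistent_le (fun p : Fin k × Fin N => Q p.1) (mixture Q) (Finset.univ.image q)
      (fun u => A.predict n fun i => u ⟨q i, Finset.mem_image_of_mem q (Finset.mem_univ i)⟩) ?_ ?_
    · exact (A.measurable_predict n).comp (by fun_prop : Measurable
        fun p : (Finset.univ.image q → X × Bool) × X =>
          ((fun i => p.1 ⟨q i, Finset.mem_image_of_mem q (Finset.mem_univ i)⟩), p.2))
    · intro h hh hb
      refine prod_correct_le Q _ ?_ hh hb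
      exact Finset.card_image_le.trans (by simpa using (Finset.mem_range.1 hn).le)
  refine (measure_mono_ae hsub).trans ((measure_biUnion_finset_le _ _).trans ?_)
  have hkN : 1 ≤ k * N := Nat.mul_pos (Nat.pos_of_ne_zero (NeZero.ne k)) hN
  calc _ ≤ ∑ n ∈ Finset.range M, ((k * N : ℕ) : ℝ≥0∞) ^ M * (1 - b) ^ (N - M) := by
        refine Finset.sum_le_sum fun n hn => (measure_iUnion_fintype_le _ _).trans ?_
        refine (Finset.sum_le_sum fun q _ => hB n hn q).trans ?_
        rw [Finset.sum_const, Finset.card_univ, nsmul_eq_mul]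
        gcongr
        rw [← Nat.cast_pow, Nat.cast_le]
        simp only [Fintype.card_fun, Fintype.card_prod, Fintype.card_fin]
        exact Nat.pow_le_pow_right hkN (Finset.mem_range.1 hn).le
    _ = _ := by rw [Finset.sum_const, Finset.card_range, nsmul_eq_mul, mul_assoc]

theorem mistake_bound_protocol (H : Set (X → Bool)) (M k : ℕ) (ε δ : ℝ)
    (hH : ∀ h ∈ H, Measurable h) (hM : optimalMistakeBound H = M) (hk : 0 < k) (hε : 0 < ε)
    (hδ : 0 < δ) :
    ∃ P : Protocol X k, P.rounds ≤ M ∧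
      ∀ c : Channel k, c.IsLockSynchronous →
        (∀ z, P.examplesSent c z ≤ M) ∧
        ∀ (D : Fin k → Measure X) (f : X → Bool), (∀ i, IsProbabilityMeasure (D i)) → f ∈ H →
          P.failureProb c (fun i => labelledBy f (D i)) (ENNReal.ofReal ε)
            ≤ ENNReal.ofReal δ := by
  have : NeZero k := ⟨hk.ne'⟩
  -- The infimum over learners lies in `ℕ∞`; being below M + 1, it yields a learner with mistake
  -- bound at most M.
  have hlt : optimalMistakeBound H < M + 1 := by
    rw [hM]
    exact_mod_cast Nat.lt_succ_self M
  obtain ⟨A, hA⟩ := iInf_lt_iff.1 hlt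
  have hA' : A.mistakeBound H ≤ M := by
    exact ENat.lt_add_one_iff (ENat.natCast_ne_top M) |>.1 hA
  obtain ⟨N, hN, hNle⟩ := exists_sampleSize k M hε hδ
  exact ⟨onlineProtocol A k M N, le_rfl, fun c hc =>
    ⟨fun z => onlineProtocol_examplesSent_le A M N hc z, fun D f _ hf =>
      (onlineProtocol_failureProb_le hH hA' hN hc D hf _).trans hNle⟩⟩

end MistakeBound

end DistLearn

end

open DistLearn in
theorem theorem1 :
    -- realizable case, one round
    (∀ δ : ℝ, 0 < δ → δ < 1 → ∃ C : ℝ,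
      ∀ (X : Type*) [MeasurableSpace X] (H : Set (X → Bool)) (d k : ℕ) (ε : ℝ),
        WellBehaved H → vcDim H = d → 0 < k → 0 < ε → ε ≤ 1 / 2 →
        ∃ (s : ℕ) (P : Fin s → Protocol X k),
          IsOneRound P (d / ε * Real.log (1 / ε)) (C * (d / ε * Real.log (1 / ε))) ∧
          ∀ (D : Fin k → Measure X) (f : X → Bool), (∀ i, IsProbabilityMeasure (D i)) → f ∈ H →
            sharedFailureProb P (fun i => labelledBy f (D i)) (ENNReal.ofReal ε)
              ≤ ENNReal.ofReal δ) ∧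
    -- realizable case, as many rounds and examples as the optimal mistake bound
    (∀ (X : Type*) [MeasurableSpace X] (H : Set (X → Bool)) (M k : ℕ) (ε δ : ℝ),
      (∀ h ∈ H, Measurable h) → optimalMistakeBound H = M → 0 < k → 0 < ε → 0 < δ →
      ∃ P : Protocol X k,
        P.rounds ≤ M ∧
        ∀ c : Channel k, c.IsLockSynchronous →
          (∀ z, P.examplesSent c z ≤ M) ∧
          ∀ (D : Fin k → Measure X) (f : X → Bool), (∀ i, IsProbabilityMeasure (D i)) → f ∈ H →
            P.failureProb c (fun i => labelledBy f (D i)) (ENNReal.ofReal ε)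
              ≤ ENNReal.ofReal δ) ∧
    -- agnostic case, one round
    (∀ δ : ℝ, 0 < δ → δ < 1 → ∃ C : ℝ,
      ∀ (X : Type*) [MeasurableSpace X] (H : Set (X → Bool)) (d k : ℕ) (ε : ℝ),
        WellBehaved H → vcDim H = d → 0 < k → 0 < ε → ε ≤ 1 / 2 →
        ∃ (s : ℕ) (P : Fin s → Protocol X k),
          IsOneRound P (d / ε ^ 2 * Real.log (1 / ε)) (C * (d / ε ^ 2 * Real.log (1 / ε))) ∧
          ∀ Q : Fin k → Measure (X × Bool), (∀ i, IsProbabilityMeasure (Q i)) →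
            sharedFailureProb P Q (opt H (mixture Q) + ENNReal.ofReal ε)
              ≤ ENNReal.ofReal δ) := by
  exact ⟨fun δ h0 h1 => ⟨_, fun X _ H d k ε hH hd hk hε hε2 =>
      one_round_realizable h0 h1 H d k ε hH hd hk hε hε2⟩,
    fun X _ H M k ε δ hH hM hk hε hδ => mistake_bound_protocol H M k ε δ hH hM hk hε hδ,
    fun δ h0 h1 => ⟨_, fun X _ H d k ε hH hd hk hε hε2 =>
      one_round_agnostic h0 h1 H d k ε hH hd hk hε hε2⟩⟩
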